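/- **Representation of the Parisi recursion by Ruelle probability cascades.** Let $k\ge 1$ and $0<m_1<m_2<\dots<m_k<1$. Consider the rooted tree with vertex set $\mathbb N^0\cup\mathbb N^1\cup\dots\cup\mathbb N^k$, in which the children of $\beta=(n_1,\dots,n_l)$, $0\le l<k$, are $\beta n=(n_1,\dots,n_l,n)$, $n\in\mathbb N$. For every vertex $\beta$ of level $l<k$ let $(x_{\beta n})_{n\in\mathbb N}$ be an enumeration of a Poisson point process on $\mathbb R$ with intensity $m_{l+1}e^{-m_{l+1}t}\,dt$, these random sequences being independent for different $\beta$. For a leaf $\alpha=(n_1,\dots,n_k)\in\mathbb N^k$ put $$z_\alpha=\sum_{l=1}^k x_{n_1\cdots n_l},\qquad \nu_\alpha=\frac{e^{z_\alpha}}{\sum_{\beta\in\mathbb N^k}e^{z_\beta}} .$$ The random weights $(\nu_\alpha)_{\alpha\in\mathbb N^k}$ are the Ruelle probability cascade with parameters $(m_1,\dots,m_k)$. Let $(g_\beta)_{\beta\in\mathbb N^1\cup\dots\cup\mathbb N^k}$ be independent standard Gaussian variables, independent of $(\nu_\alpha)$, and set $G_\alpha=(g_{n_1},g_{n_1n_2},\dots,g_{n_1\cdots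 n_k})$. Let $\psi_k:\mathbb R^k\to\mathbb R$ be a measurable function with $\mathbb E\exp(\psi_k(g_1,\dots,g_k))<\infty$ for $g_1,\dots,g_k$ i.i.d. standard Gaussian, and define recursively, for $l=k-1,\dots,0$, $$\psi_l(g_1,\dots,g_l)=\frac1{m_{l+1}}\log\mathbb E\Big[\exp\big(m_{l+1}\psi_{l+1}(g_1,\dots,g_{l+1})\big)\,\Big|\,g_1,\dots,g_l\Big].$$ Then $\sum_\beta e^{z_\beta}<\infty$ almost surely, $\mathbb E\exp\big(m_{l}\psi_{l}(g_1,\dots,g_{l})\big)<\infty$ for $1\le l\le k$, the series $\sum_\alpha\nu_\alpha e^{\psi_k(G_\alpha)}$ converges almost surely, its logarithm is integrable, and $$\psi_0=\mathbb E\Big[\log\Big(\sum_{\alpha\in\mathbb N^k}\nu_\alpha\exp\big(\psi_k(G_\alpha)\big)\Big)\Big].$$ -/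

import Mathlib

open MeasureTheory ProbabilityTheory
open scoped ENNReal

noncomputable section

/-- `N` is a Poisson point process with intensity measure `Λ`: the number of points in a
measurable set `B` has the Poisson law with mean `Λ B` (it is almost surely infinite if
`Λ B = ∞`), and the numbers of points in disjoint measurable sets are independent. Here `N ω B` is
the number of points in `B`. -/
structure IsPoissonPointProcess {Ω E : Type*} [MeasurableSpace Ω] [MeasurableSpace E]
    (N : Ω → Measure E) (Λ : Measure E) (P : Measure Ω) : Prop where
  hasLaw_poisson : ∀ B : Set E, MeasurableSet B → Λ B ≠ ∞ →
    HasLaw (fun ω => N ω B)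
      ((poissonMeasure (Λ B).toNNReal).map (fun n : ℕ => (n : ℝ≥0∞))) P
  ae_eq_top : ∀ B : Set E, MeasurableSet B → Λ B = ∞ → ∀ᵐ ω ∂P, N ω B = ∞
  iIndepFun_of_disjoint : ∀ (n : ℕ) (B : Fin n → Set E), (∀ i, MeasurableSet (B i)) →
    Pairwise (fun i j => Disjoint (B i) (B j)) →
    iIndepFun (fun (i : Fin n) (ω : Ω) => N ω (B i)) P

/-- The counting measure of a sequence of points: `B ↦ #{n | x n ∈ B}`. -/
def countingOfPoints (x : ℕ → ℝ) : Measure ℝ :=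
  Measure.sum fun n => Measure.dirac (x n)

/-- The measure `a * exp (-a t) dt` on the whole real line. -/
def expIntensity (a : ℝ) : Measure ℝ :=
  volume.withDensity fun t => ENNReal.ofReal (a * Real.exp (-a * t))

/-- The vertices of levels `0, …, k - 1` of the infinitary tree of depth `k`, that is, all the
vertices that have children. A vertex of level `l` is a sequence of `l` natural numbers. -/
abbrev InternalVertex (k : ℕ) : Type := Σ l : Fin k, (Fin (l : ℕ) → ℕ)

/-- The vertices of levels `1, …, k`, that is, all the vertices except for the root. The pair
`⟨l, β⟩` is the vertex `β` of level `l + 1`. -/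
abbrev NonRootVertex (k : ℕ) : Type := Σ l : Fin k, (Fin ((l : ℕ) + 1) → ℕ)

/-- The `n`-th child `(n₁, …, n_l, n)` of the vertex `(n₁, …, n_l)`. -/
def InternalVertex.child {k : ℕ} (v : InternalVertex k) (n : ℕ) : NonRootVertex k :=
  ⟨v.1, Fin.snoc (α := fun _ => ℕ) v.2 n⟩

/-- For a leaf `α = (n₁, …, n_k)`, the vertex `(n₁, …, n_{l+1})` of level `l + 1` on the path from
the root to `α`. -/
def pathVertex {k : ℕ} (α : Fin k → ℕ) (l : Fin k) : NonRootVertex k :=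
  ⟨l, fun i => α (Fin.castLE l.isLt i)⟩

/-- The points `x` on the non-root vertices of the tree form a cascade of Poisson processes with
parameters `m` (`m l` is the parameter of the points of level `l + 1`): the points attached to the
children of a vertex of level `l` are an enumeration of a Poisson point process with intensity
`m l * exp (- m l * t) dt`, and these enumerated processes are independent for different parent
vertices. -/
structure IsPoissonCascade {Ω : Type*} [MeasurableSpace Ω] {k : ℕ} (m : Fin k → ℝ)
    (x : NonRootVertex k → Ω → ℝ) (P : Measure Ω) : Prop where
  measurable : ∀ v, Measurable (x v)
  isPoisson : ∀ v : InternalVertex k,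
    IsPoissonPointProcess (fun ω => countingOfPoints fun n => x (v.child n) ω)
      (expIntensity (m v.1)) P
  iIndepFun_children :
    iIndepFun (fun (v : InternalVertex k) (ω : Ω) (n : ℕ) => x (v.child n) ω) P

/-- `z_α`, the sum of the points along the path from the root to the leaf `α`. -/
def cascadeSum {Ω : Type*} {k : ℕ} (x : NonRootVertex k → Ω → ℝ) (α : Fin k → ℕ) (ω : Ω) : ℝ :=
  ∑ l : Fin k, x (pathVertex α l) ω

/-- `ν_α = exp (z_α) / ∑_β exp (z_β)`, the weights of the Ruelle probability cascade. -/
def ruelleWeight {Ω : Type*} {k : ℕ} (x : NonRootVertex k → Ω → ℝ) (α : Fin k → ℕ) (ω : Ω) : ℝ :=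
  Real.exp (cascadeSum x α ω) / ∑' β : Fin k → ℕ, Real.exp (cascadeSum x β ω)

/-- `G_α`, the vector of the labels along the path from the root to the leaf `α`. -/
def pathLabels {Ω : Type*} {k : ℕ} (g : NonRootVertex k → Ω → ℝ) (α : Fin k → ℕ) (ω : Ω) :
    Fin k → ℝ :=
  fun l => g (pathVertex α l) ω

/-- The standard Gaussian law of `(g₁, …, g_l)`. -/
def stdGaussianVec (l : ℕ) : Measure (Fin l → ℝ) :=
  Measure.pi fun _ => gaussianReal 0 1

/-- One step of the recursion:
`(y₁, …, y_l) ↦ (1 / a) * log E [exp (a * f (y₁, …, y_l, g))]` with `g` standard Gaussian. -/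
def parisiStep (a : ℝ) {l : ℕ} (f : (Fin (l + 1) → ℝ) → ℝ) (y : Fin l → ℝ) : ℝ :=
  1 / a * Real.log
    (∫ t, Real.exp (a * f (Fin.snoc (α := fun _ => ℝ) y t)) ∂(gaussianReal 0 1))

/-- The function `ψ_l` of `(g₁, …, g_l)`, for `l ≤ k`, obtained from `ψ = ψ_k` by the recursion;
see `parisiPsi_self` and `parisiPsi_of_lt`. -/
def parisiPsi {k : ℕ} (m : Fin k → ℝ) (ψ : (Fin k → ℝ) → ℝ) (l : ℕ) (hl : l ≤ k) :
    (Fin l → ℝ) → ℝ :=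
  Nat.decreasingInduction (motive := fun l _ => (Fin l → ℝ) → ℝ)
    (fun l h f => parisiStep (m ⟨l, h⟩) f) ψ hl

theorem parisiPsi_self {k : ℕ} (m : Fin k → ℝ) (ψ : (Fin k → ℝ) → ℝ) :
    parisiPsi m ψ k le_rfl = ψ := by
  simp [parisiPsi]

theorem parisiPsi_of_lt {k : ℕ} (m : Fin k → ℝ) (ψ : (Fin k → ℝ) → ℝ) (l : ℕ) (hl : l < k) :
    parisiPsi m ψ l hl.le = parisiStep (m ⟨l, hl⟩) (parisiPsi m ψ (l + 1) hl) := by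
  unfold parisiPsi
  rw [Nat.decreasingInduction_succ_left _ _ hl]

end

/-! A Poisson process with intensity `a e^{-at} dt` is stable: for `a < s` and independent i.i.d.
marks `u_n`, the sum `Σ e^{s x_n} u_n` has Laplace transform `exp (-c λ^{a/s} E[u^{a/s}])`, so the
marks enter through one moment only (`lintegral_expNeg_tsum_exp_mul`). Apply this to the children of
each vertex of level `l`, conditionally on the levels above. Inside the Laplace transform, a sum
over level `l + 1` with factors `e^{s z}` and labels `f` becomes a sum over level `l` with factors
`e^{m z}` and labels `E[f^{m/s}]`, where `m = m_{l+1}`: this is one step of the Parisi recursion. At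
the root, `S = Σ e^{z_α} e^{ψ(G_α)}` satisfies `E e^{-λS} = exp (-C λ^{m₁} e^{m₁ψ₀})` with `C`
independent of `ψ` (`exists_hasStableLaplace`). Taking `ψ = 0` gives the same for `T = Σ e^{z_α}`.
So `S` behaves like `e^{ψ₀} T`, and `E log (S/T) = ψ₀` once both logarithms are integrable.

Integrability and the comparison of logarithms come from moments. Integrating the Laplace transform
against `e^{∓qt} dt`, `λ = e^t`, computes `E S^{±q}` for `0 < q < m₁`. Hence `0 < S < ∞` almost
surely, `log S` has exponential moments near `0`, and `E log S` is the derivative of its moment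
generating function at `0`.

The labels are assumed independent of the weights, not of the points. The computation is therefore
made with fresh marks on a product space and carried back through the joint law of weights and
labels. Working in `[0, ∞]` requires no convergence in advance. -/

open Filter Topology

/-! ### Laplace transforms of sums with values in `[0, ∞]` -/

/-- The function `a ↦ exp (-a)` on `[0, ∞]`. -/
noncomputable def expNeg (a : ℝ≥0∞) : ℝ≥0∞ := EReal.exp (-(a : EReal))

lemma continuous_expNeg : Continuous expNeg :=
  ENNReal.continuous_exp.comp (continuous_neg.comp continuous_coe_ennreal_ereal)

lemma measurable_expNeg : Measurable expNeg := continuous_expNeg.measurable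

@[fun_prop]
lemma Measurable.expNeg {α : Type*} [MeasurableSpace α] {f : α → ℝ≥0∞} (hf : Measurable f) :
    Measurable fun a => expNeg (f a) := measurable_expNeg.comp hf

@[simp] lemma expNeg_zero : expNeg 0 = 1 := by simp [expNeg]

@[simp] lemma expNeg_top : expNeg ∞ = 0 := by simp [expNeg]

lemma expNeg_ofReal {r : ℝ} (hr : 0 ≤ r) :
    expNeg (ENNReal.ofReal r) = ENNReal.ofReal (Real.exp (-r)) := by
  rw [expNeg, EReal.coe_ennreal_ofReal, max_eq_left hr, ← EReal.coe_neg, EReal.exp_coe]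

lemma expNeg_strictAnti : StrictAnti expNeg := fun _ _ h =>
  EReal.exp_strictMono (EReal.neg_strictAnti (EReal.coe_ennreal_strictMono h))

lemma one_sub_expNeg_ne_zero {u : ℝ≥0∞} (hu : u ≠ 0) : 1 - expNeg u ≠ 0 := by
  have := expNeg_strictAnti (pos_iff_ne_zero.2 hu)
  rw [expNeg_zero] at this
  exact (tsub_pos_of_lt this).ne'

lemma expNeg_le_one (a : ℝ≥0∞) : expNeg a ≤ 1 := by
  simpa using expNeg_strictAnti.antitone (zero_le (a := a))

lemma expNeg_ne_top (a : ℝ≥0∞) : expNeg a ≠ ∞ :=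
  ((expNeg_le_one a).trans_lt ENNReal.one_lt_top).ne

lemma expNeg_add (a b : ℝ≥0∞) : expNeg (a + b) = expNeg a * expNeg b := by
  rw [expNeg, EReal.coe_ennreal_add, EReal.neg_add (Or.inl (EReal.coe_ennreal_ne_bot a))
    (Or.inr (EReal.coe_ennreal_ne_bot b)), sub_eq_add_neg, EReal.exp_add]
  rfl

lemma expNeg_sum {ι : Type*} (s : Finset ι) (f : ι → ℝ≥0∞) :
    expNeg (∑ i ∈ s, f i) = ∏ i ∈ s, expNeg (f i) := by
  classical
  induction s using Finset.induction_on with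
  | empty => simp
  | insert a s ha ih => rw [Finset.sum_insert ha, Finset.prod_insert ha, expNeg_add, ih]

/-- The inverse of `expNeg` on `[0, 1]`. -/
noncomputable def negLog (p : ℝ≥0∞) : ℝ≥0∞ := (-(ENNReal.log p)).toENNReal

lemma measurable_negLog : Measurable negLog :=
  measurable_ereal_toENNReal.comp (continuous_neg.measurable.comp ENNReal.measurable_log)

@[fun_prop]
lemma Measurable.negLog {α : Type*} [MeasurableSpace α] {f : α → ℝ≥0∞} (hf : Measurable f) :
    Measurable fun a => negLog (f a) := measurable_negLog.comp hf

lemma expNeg_negLog {p : ℝ≥0∞} (hp : p ≤ 1) : expNeg (negLog p) = p := by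
  rw [expNeg, negLog, EReal.coe_toENNReal, neg_neg, ENNReal.exp_log]
  have := ENNReal.log_le_zero_iff.2 hp
  exact EReal.neg_nonneg.2 this

lemma negLog_expNeg (a : ℝ≥0∞) : negLog (expNeg a) = a :=
  expNeg_strictAnti.injective (expNeg_negLog (expNeg_le_one a))

lemma tendsto_expNeg_tsum {ι : Type*} (f : ι → ℝ≥0∞) :
    Tendsto (fun s : Finset ι => ∏ i ∈ s, expNeg (f i)) atTop (𝓝 (expNeg (∑' i, f i))) := by
  have h := (continuous_expNeg.tendsto _).comp (ENNReal.summable (f := f)).hasSum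
  exact h.congr fun s => expNeg_sum s f

lemma lintegral_expNeg_le_one {Ω : Type*} [MeasurableSpace Ω] (P : Measure Ω)
    [IsProbabilityMeasure P] (f : Ω → ℝ≥0∞) : ∫⁻ ω, expNeg (f ω) ∂P ≤ 1 := by
  calc _ ≤ ∫⁻ _, 1 ∂P := lintegral_mono fun ω => expNeg_le_one _
    _ = 1 := by simp

lemma tendsto_lintegral_expNeg {Ω ι : Type*} [MeasurableSpace Ω] (P : Measure Ω)
    [IsProbabilityMeasure P] {l : Filter ι} [l.IsCountablyGenerated] {F : ι → Ω → ℝ≥0∞}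
    {f : Ω → ℝ≥0∞} (hF : ∀ i, Measurable (F i))
    (h : ∀ᵐ ω ∂P, Tendsto (fun i => F i ω) l (𝓝 (f ω))) :
    Tendsto (fun i => ∫⁻ ω, expNeg (F i ω) ∂P) l (𝓝 (∫⁻ ω, expNeg (f ω) ∂P)) := by
  refine tendsto_lintegral_filter_of_dominated_convergence (fun _ => 1)
    (Eventually.of_forall fun i => (hF i).expNeg)
    (Eventually.of_forall fun i => ae_of_all _ fun ω => expNeg_le_one _) (by simp) ?_
  filter_upwards [h] with ω hω
  exact (continuous_expNeg.tendsto _).comp hω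

/-- The Laplace transform of a countable sum of independent random variables. -/
lemma lintegral_expNeg_tsum {Ω ι : Type*} [MeasurableSpace Ω] {P : Measure Ω} [Countable ι]
    {X : ι → Ω → ℝ≥0∞} (hX : ∀ i, Measurable (X i)) (h : iIndepFun X P) :
    ∫⁻ ω, expNeg (∑' i, X i ω) ∂P = expNeg (∑' i, negLog (∫⁻ ω, expNeg (X i ω) ∂P)) := by
  have := h.isProbabilityMeasure
  have h1 : Tendsto (fun s : Finset ι => ∫⁻ ω, expNeg (∑ i ∈ s, X i ω) ∂P) atTop
      (𝓝 (∫⁻ ω, expNeg (∑' i, X i ω) ∂P)) :=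
    tendsto_lintegral_expNeg P (fun s => by fun_prop)
      (ae_of_all _ fun ω => (ENNReal.summable (f := fun i => X i ω)).hasSum)
  refine tendsto_nhds_unique h1 ?_
  -- The infinite product of transforms is encoded as `expNeg` of a sum of `negLog`: only finite
  -- products occur, and a vanishing factor is a term `∞`.
  convert! tendsto_expNeg_tsum (fun i => negLog (∫⁻ ω, expNeg (X i ω) ∂P)) using 2 with s
  simp_rw [expNeg_sum]
  rw [lintegral_prod_eq_prod_lintegral_of_indepFun s (fun i ω => expNeg (X i ω))
    (h.comp (fun _ => expNeg) fun _ => measurable_expNeg) fun i => (hX i).expNeg]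
  exact Finset.prod_congr rfl fun i _ => (expNeg_negLog (lintegral_expNeg_le_one P _)).symm

/-- The Laplace transform of a countable sum whose terms are independent conditionally on `H`. -/
lemma lintegral_expNeg_tsum_of_indepFun {Ω 𝓗 ι : Type*} {E : ι → Type*} [MeasurableSpace Ω]
    [MeasurableSpace 𝓗] [∀ i, MeasurableSpace (E i)] {P : Measure Ω} [Countable ι]
    {H : Ω → 𝓗} {w : ∀ i, Ω → E i} (hH : Measurable H) (hw : ∀ i, Measurable (w i))
    (hHw : IndepFun H (fun ω i => w i ω) P) (hww : iIndepFun w P)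
    (f : ∀ i, 𝓗 → E i → ℝ≥0∞) (hf : ∀ i, Measurable (Function.uncurry (f i))) :
    ∫⁻ ω, expNeg (∑' i, f i (H ω) (w i ω)) ∂P =
      ∫⁻ ω, expNeg (∑' i, negLog (∫⁻ ω', expNeg (f i (H ω) (w i ω')) ∂P)) ∂P := by
  have := hww.isProbabilityMeasure
  have hW : Measurable (fun ω i => w i ω) := measurable_pi_lambda _ hw
  have hmap := (indepFun_iff_map_prod_eq_prod_map_map hH.aemeasurable hW.aemeasurable).1 hHw
  have hF : Measurable fun p : 𝓗 × (∀ i, E i) => expNeg (∑' i, f i p.1 (p.2 i)) := by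
    refine Measurable.expNeg (Measurable.tsum fun i => ?_)
    exact (hf i).comp (by fun_prop : Measurable fun p : 𝓗 × (∀ i, E i) => (p.1, p.2 i))
  have hp : IsProbabilityMeasure (P.map fun ω i => w i ω) :=
    Measure.isProbabilityMeasure_map hW.aemeasurable
  calc ∫⁻ ω, expNeg (∑' i, f i (H ω) (w i ω)) ∂P
      = ∫⁻ p, expNeg (∑' i, f i p.1 (p.2 i)) ∂(P.map fun ω => (H ω, fun i => w i ω)) := by
        rw [lintegral_map hF (hH.prodMk hW)]
    _ = ∫⁻ ω, ∫⁻ ω', expNeg (∑' i, f i (H ω) (w i ω')) ∂P ∂P := by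
        rw [hmap, lintegral_prod _ hF.aemeasurable, lintegral_map hF.lintegral_prod_right' hH]
        refine lintegral_congr fun ω => ?_
        exact lintegral_map (hF.comp measurable_prodMk_left) hW
    _ = _ := by
        refine lintegral_congr fun ω => ?_
        exact lintegral_expNeg_tsum (X := fun i ω' => f i (H ω) (w i ω'))
          (fun i => ((hf i).comp measurable_prodMk_left).comp (hw i))
          (hww.comp (fun i => f i (H ω)) fun i => (hf i).comp measurable_prodMk_left)

/-! ### Laplace functionals of Poisson processes -/

lemma lintegral_expNeg_mul_poissonMeasure (r : NNReal) (a : ℝ≥0∞) :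
    ∫⁻ n, expNeg (a * (n : ℝ≥0∞)) ∂(poissonMeasure r) = expNeg ((1 - expNeg a) * r) := by
  -- With `q = e^{-a}` this is the Poisson generating function `E q^n = e^{-(1-q)r}`; the case `a =
  -- ∞` is `q = 0`.
  obtain ⟨q, hq⟩ : ∃ q : NNReal, expNeg a = q := ⟨_, (ENNReal.coe_toNNReal (expNeg_ne_top a)).symm⟩
  have hq1 : (q : ℝ) ≤ 1 := by
    have := expNeg_le_one a
    rw [hq] at this
    exact_mod_cast this
  have hpow : ∀ n : ℕ, expNeg (a * (n : ℝ≥0∞)) = ENNReal.ofReal ((q : ℝ) ^ n) := fun n => by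
    have h := expNeg_sum (Finset.range n) fun _ => a
    simp only [Finset.sum_const, Finset.card_range, nsmul_eq_mul, Finset.prod_const, hq] at h
    rw [mul_comm, h, ENNReal.ofReal_pow q.coe_nonneg, ENNReal.ofReal_coe_nnreal]
  have hsum : HasSum (fun n : ℕ => Real.exp (-r) * ((r * q : ℝ) ^ n / n.factorial))
      (Real.exp (-r) * Real.exp (r * q)) := by
    refine HasSum.mul_left _ ?_
    rw [Real.exp_eq_exp_ℝ]
    exact NormedSpace.expSeries_div_hasSum_exp (r * q : ℝ)
  have hexp : expNeg ((1 - expNeg a) * r) = ENNReal.ofReal (Real.exp (-r) * Real.exp (r * q)) := by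
    rw [hq, ← ENNReal.ofReal_coe_nnreal (p := q), ← ENNReal.ofReal_one,
      ← ENNReal.ofReal_sub _ q.coe_nonneg, ← ENNReal.ofReal_coe_nnreal (p := r),
      ← ENNReal.ofReal_mul (by linarith), expNeg_ofReal (mul_nonneg (by linarith) r.coe_nonneg),
      ← Real.exp_add]
    ring_nf
  rw [hexp, ← hsum.tsum_eq, ENNReal.ofReal_tsum_of_nonneg (fun n => by positivity) hsum.summable,
    lintegral_countable']
  refine tsum_congr fun n => ?_
  rw [hpow, poissonMeasure_singleton, ← ENNReal.ofReal_mul (by positivity)]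
  congr 1
  rw [mul_pow]
  ring

namespace IsPoissonPointProcess

variable {Ω E : Type*} [MeasurableSpace Ω] [MeasurableSpace E]
  {N : Ω → Measure E} {Λ : Measure E} {P : Measure Ω} [IsProbabilityMeasure P]

lemma lintegral_expNeg_mul_measure (h : IsPoissonPointProcess N Λ P) {B : Set E}
    (hB : MeasurableSet B) (a : ℝ≥0∞) :
    ∫⁻ ω, expNeg (a * N ω B) ∂P = expNeg ((1 - expNeg a) * Λ B) := by
  by_cases hΛ : Λ B = ∞
  · rcases eq_or_ne a 0 with rfl | ha
    · simp
    · rw [hΛ, ENNReal.mul_top (one_sub_expNeg_ne_zero ha), expNeg_top]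
      refine (lintegral_congr_ae ?_).trans lintegral_zero
      filter_upwards [h.ae_eq_top B hB hΛ] with ω hω
      rw [hω, ENNReal.mul_top ha, expNeg_top]
  · have hlaw := h.hasLaw_poisson B hB hΛ
    have hm : Measurable fun y : ℝ≥0∞ => expNeg (a * y) := by fun_prop
    rw [← lintegral_map' (f := fun y => expNeg (a * y)) hm.aemeasurable hlaw.aemeasurable,
      hlaw.map_eq, lintegral_map hm .of_discrete, lintegral_expNeg_mul_poissonMeasure,
      ENNReal.coe_toNNReal hΛ]

/-- The fibres of a simple function are disjoint, so the counts on them are independent and the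
transform factorizes. -/
lemma lintegral_expNeg_lintegral_simpleFunc (h : IsPoissonPointProcess N Λ P) (hN : Measurable N)
    (f : SimpleFunc E ℝ≥0∞) :
    ∫⁻ ω, expNeg (∫⁻ t, f t ∂(N ω)) ∂P = expNeg (∫⁻ t, (1 - expNeg (f t)) ∂Λ) := by
  let e := f.range.equivFin.symm
  have hr : ∫⁻ t, (1 - expNeg (f t)) ∂Λ =
      ∑ i, (1 - expNeg (e i : ℝ≥0∞)) * Λ (f ⁻¹' {(e i : ℝ≥0∞)}) := by
    have := SimpleFunc.map_lintegral (μ := Λ) (fun a => 1 - expNeg a) f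
    rw [← SimpleFunc.lintegral_eq_lintegral] at this
    simp only [SimpleFunc.map_apply] at this
    rw [this, ← Finset.sum_coe_sort]
    exact (Equiv.sum_comp e _).symm
  have hl : ∀ ω, ∫⁻ t, f t ∂(N ω) = ∑ i, (e i : ℝ≥0∞) * N ω (f ⁻¹' {(e i : ℝ≥0∞)}) := fun ω => by
    rw [SimpleFunc.lintegral_eq_lintegral, SimpleFunc.lintegral, ← Finset.sum_coe_sort]
    exact (Equiv.sum_comp e _).symm
  have hB : ∀ i, MeasurableSet (f ⁻¹' {(e i : ℝ≥0∞)}) := fun i => f.measurableSet_preimage _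
  have hind := h.iIndepFun_of_disjoint _ (fun i => f ⁻¹' {(e i : ℝ≥0∞)}) hB (fun i j hij =>
    Disjoint.preimage _ (Set.disjoint_singleton.2 fun h' =>
      hij (e.injective (Subtype.ext h'))))
  have hind' := hind.comp (fun i y => expNeg ((e i : ℝ≥0∞) * y)) fun i => by fun_prop
  simp_rw [hr, hl, expNeg_sum]
  refine (lintegral_prod_eq_prod_lintegral_of_indepFun Finset.univ _ hind' fun i =>
    (by fun_prop : Measurable fun y => expNeg ((e i : ℝ≥0∞) * y)).comp
      ((Measure.measurable_coe (hB i)).comp hN)).trans ?_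
  exact Finset.prod_congr rfl fun i _ => h.lintegral_expNeg_mul_measure (hB i) _

/-- The Laplace functional of a Poisson point process. -/
theorem lintegral_expNeg_lintegral (h : IsPoissonPointProcess N Λ P) (hN : Measurable N)
    {f : E → ℝ≥0∞} (hf : Measurable f) :
    ∫⁻ ω, expNeg (∫⁻ t, f t ∂(N ω)) ∂P = expNeg (∫⁻ t, (1 - expNeg (f t)) ∂Λ) := by
  have hmono := SimpleFunc.monotone_eapprox f
  have hlim : ∀ t, Tendsto (fun n => SimpleFunc.eapprox f n t) atTop (𝓝 (f t)) :=
    SimpleFunc.tendsto_eapprox hf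
  have h1 := tendsto_lintegral_expNeg P (l := atTop)
    (F := fun n ω => ∫⁻ t, SimpleFunc.eapprox f n t ∂(N ω)) (f := fun ω => ∫⁻ t, f t ∂(N ω))
    (fun n => (Measure.measurable_lintegral (SimpleFunc.measurable _)).comp hN)
    (ae_of_all _ fun ω => lintegral_tendsto_of_tendsto_of_monotone
      (fun n => (SimpleFunc.measurable _).aemeasurable)
      (ae_of_all _ fun t m n hmn => hmono hmn t) (ae_of_all _ hlim))
  have h2 : Tendsto (fun n => ∫⁻ t, (1 - expNeg (SimpleFunc.eapprox f n t)) ∂Λ) atTop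
      (𝓝 (∫⁻ t, (1 - expNeg (f t)) ∂Λ)) := by
    refine lintegral_tendsto_of_tendsto_of_monotone
      (fun n => (measurable_const.sub (SimpleFunc.measurable _).expNeg).aemeasurable)
      (ae_of_all _ fun t m n hmn => tsub_le_tsub_left (expNeg_strictAnti.antitone (hmono hmn t)) _)
      (ae_of_all _ fun t => ?_)
    exact ENNReal.Tendsto.sub tendsto_const_nhds ((continuous_expNeg.tendsto _).comp (hlim t))
      (Or.inl ENNReal.one_ne_top)
  refine tendsto_nhds_unique h1 ?_
  simp_rw [h.lintegral_expNeg_lintegral_simpleFunc hN]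
  exact (continuous_expNeg.tendsto _).comp h2

end IsPoissonPointProcess

lemma measurable_countingOfPoints {Ω : Type*} [MeasurableSpace Ω] {x : ℕ → Ω → ℝ}
    (hx : ∀ n, Measurable (x n)) : Measurable fun ω => countingOfPoints fun n => x n ω := by
  refine Measure.measurable_of_measurable_coe _ fun s hs => ?_
  simp only [countingOfPoints, Measure.sum_apply _ hs]
  exact Measurable.tsum fun n => (Measure.measurable_coe hs).comp
    (Measure.measurable_dirac.comp (hx n))

/-- The Laplace transform of a sum over the points of a Poisson process with independent marks. -/
theorem lintegral_expNeg_tsum_of_marked {Ω E : Type*} [MeasurableSpace Ω] [MeasurableSpace E]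
    {P : Measure Ω} [IsProbabilityMeasure P] {Λ : Measure ℝ} {γ : Measure E}
    {x : ℕ → Ω → ℝ} {g : ℕ → Ω → E} (hx : ∀ n, Measurable (x n)) (hg : ∀ n, Measurable (g n))
    (hΛ : IsPoissonPointProcess (fun ω => countingOfPoints fun n => x n ω) Λ P)
    (hγ : ∀ n, P.map (g n) = γ) (hgg : iIndepFun g P)
    (hxg : IndepFun (fun ω n => x n ω) (fun ω n => g n ω) P)
    {f : ℝ → E → ℝ≥0∞} (hf : Measurable (Function.uncurry f)) :
    ∫⁻ ω, expNeg (∑' n, f (x n ω) (g n ω)) ∂P =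
      expNeg (∫⁻ t, (1 - ∫⁻ y, expNeg (f t y) ∂γ) ∂Λ) := by
  have hγp : IsProbabilityMeasure γ := hγ 0 ▸ Measure.isProbabilityMeasure_map (hg 0).aemeasurable
  have hN := measurable_countingOfPoints hx
  have hexp : Measurable fun t => ∫⁻ y, expNeg (f t y) ∂γ := hf.expNeg.lintegral_prod_right'
  rw [lintegral_expNeg_tsum_of_indepFun (measurable_pi_lambda _ hx) hg hxg hgg
    (fun n h y => f (h n) y) fun n =>
      hf.comp (by fun_prop : Measurable fun p : (ℕ → ℝ) × E => (p.1 n, p.2))]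
  have h1 : ∀ n ω, ∫⁻ ω', expNeg (f (x n ω) (g n ω')) ∂P = ∫⁻ y, expNeg (f (x n ω) y) ∂γ := by
    intro n ω
    rw [← hγ n]
    exact (lintegral_map (hf.comp measurable_prodMk_left).expNeg (hg n)).symm
  simp_rw [h1]
  -- Averaging the marks given the points leaves a sum over points of `negLog (E e^{-f})`, to which
  -- the Laplace functional applies.
  have h2 := hΛ.lintegral_expNeg_lintegral hN hexp.negLog
  simp only [expNeg_negLog (lintegral_expNeg_le_one γ _)] at h2
  rw [← h2]
  refine lintegral_congr fun ω => ?_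
  rw [countingOfPoints, lintegral_sum_measure]
  simp_rw [lintegral_dirac' _ hexp.negLog]

/-! ### Scaling integrals for the exponential intensity -/

lemma lintegral_exp_mul_comp_exp_mul (h : ℝ≥0∞ → ℝ≥0∞) (a : ℝ) {s : ℝ} (hs : 0 < s)
    {u : ℝ≥0∞} (hu0 : u ≠ 0) (hu : u ≠ ∞) :
    ∫⁻ t, ENNReal.ofReal (Real.exp (-a * t)) * h (ENNReal.ofReal (Real.exp (s * t)) * u) =
      (∫⁻ t, ENNReal.ofReal (Real.exp (-a * t)) * h (ENNReal.ofReal (Real.exp (s * t)))) *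
        u ^ (a / s) := by
  -- Writing `u = e^{sr}` turns multiplication by `u` into the translation `t ↦ t + r`, which
  -- changes `e^{-at}` by a constant factor.
  obtain ⟨r, hr⟩ : ∃ r : ℝ, u = ENNReal.ofReal (Real.exp (s * r)) := by
    refine ⟨Real.log u.toReal / s, ?_⟩
    rw [mul_div_cancel₀ _ hs.ne', Real.exp_log (ENNReal.toReal_pos hu0 hu), ENNReal.ofReal_toReal hu]
  rw [hr, ENNReal.ofReal_rpow_of_pos (Real.exp_pos _), ← Real.exp_mul,
    ← lintegral_mul_const' _ _ ENNReal.ofReal_ne_top,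
    ← lintegral_add_right_eq_self (μ := volume)
      (fun t => ENNReal.ofReal (Real.exp (-a * t)) * h (ENNReal.ofReal (Real.exp (s * t))) *
        ENNReal.ofReal (Real.exp (s * r * (a / s)))) r]
  refine lintegral_congr fun t => ?_
  rw [mul_right_comm, ← ENNReal.ofReal_mul (Real.exp_pos _).le, ← Real.exp_add,
    ← ENNReal.ofReal_mul (Real.exp_pos _).le, ← Real.exp_add, mul_add s t r]
  congr 3
  field_simp
  ring

lemma lintegral_ne_zero_of_forall {f : ℝ → ℝ≥0∞} (hf : Measurable f) (h : ∀ t, f t ≠ 0) :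
    ∫⁻ t, f t ≠ 0 := by
  rw [ne_eq, lintegral_eq_zero_iff hf]
  intro h0
  obtain ⟨t, ht⟩ := h0.exists
  exact h t ht

/-- By scaling with `u = e`, the integral `I` satisfies `I = e^a I`; being nonzero, it cannot be
finite. -/
lemma lintegral_exp_mul_eq_top {a : ℝ} (ha : a ≠ 0) :
    ∫⁻ t, ENNReal.ofReal (Real.exp (-a * t)) = ∞ := by
  by_contra hne
  have h := lintegral_exp_mul_comp_exp_mul (fun _ => 1) a one_pos (u := ENNReal.ofReal (Real.exp 1))
    (by simp [Real.exp_pos]) ENNReal.ofReal_ne_top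
  simp only [mul_one, div_one] at h
  have h0 : ∫⁻ t, ENNReal.ofReal (Real.exp (-a * t)) ≠ 0 :=
    lintegral_ne_zero_of_forall (by fun_prop) fun t => by simp [Real.exp_pos]
  rw [ENNReal.ofReal_rpow_of_pos (Real.exp_pos _), Real.exp_one_rpow] at h
  have h1 : ENNReal.ofReal (Real.exp a) = 1 :=
    (ENNReal.mul_right_inj h0 hne).1 (by rw [← h, mul_one])
  rw [ENNReal.ofReal_eq_one, Real.exp_eq_one_iff] at h1
  exact ha h1

/-- The constant `∫ (1 - exp (-exp (s t))) exp (-a t) dt`. -/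
noncomputable def stableConst (a s : ℝ) : ℝ≥0∞ :=
  ∫⁻ t, ENNReal.ofReal (Real.exp (-a * t)) * (1 - expNeg (ENNReal.ofReal (Real.exp (s * t))))

/-- The constant `∫ exp (-exp (s t)) exp (a t) dt`. -/
noncomputable def gumbelConst (a s : ℝ) : ℝ≥0∞ :=
  ∫⁻ t, ENNReal.ofReal (Real.exp (-(-a) * t)) * expNeg (ENNReal.ofReal (Real.exp (s * t)))

lemma expNeg_ne_zero {u : ℝ≥0∞} (hu : u ≠ ∞) : expNeg u ≠ 0 := by
  have := expNeg_strictAnti (lt_top_iff_ne_top.2 hu)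
  rw [expNeg_top] at this
  exact this.ne'

lemma stableConst_ne_zero (a s : ℝ) : stableConst a s ≠ 0 := by
  refine lintegral_ne_zero_of_forall (by fun_prop) fun t => mul_ne_zero ?_ ?_
  · simp [Real.exp_pos]
  · exact one_sub_expNeg_ne_zero (by simp [Real.exp_pos])

lemma gumbelConst_ne_zero (a s : ℝ) : gumbelConst a s ≠ 0 := by
  refine lintegral_ne_zero_of_forall (by fun_prop) fun t => mul_ne_zero ?_ ?_
  · simp [Real.exp_pos]
  · exact expNeg_ne_zero ENNReal.ofReal_ne_top

lemma lintegral_ne_top_of_le_exp {f : ℝ → ℝ≥0∞} {a b : ℝ} (ha : 0 < a) (hb : 0 < b)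
    (h1 : ∀ t ≤ 0, f t ≤ ENNReal.ofReal (Real.exp (a * t)))
    (h2 : ∀ t, 0 < t → f t ≤ ENNReal.ofReal (Real.exp (-b * t))) : ∫⁻ t, f t ≠ ∞ := by
  rw [← lintegral_add_compl f (measurableSet_Iic (a := (0 : ℝ))), Set.compl_Iic]
  have i1 : IntegrableOn (fun t => Real.exp (a * t)) (Set.Iic 0) := integrableOn_exp_mul_Iic ha 0
  have i2 : IntegrableOn (fun t => Real.exp (-b * t)) (Set.Ioi 0) := exp_neg_integrableOn_Ioi 0 hb
  refine ENNReal.add_ne_top.2 ⟨ne_top_of_le_ne_top i1.lintegral_lt_top.ne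
    (setLIntegral_mono' measurableSet_Iic h1), ne_top_of_le_ne_top i2.lintegral_lt_top.ne
    (setLIntegral_mono' measurableSet_Ioi h2)⟩

/-- At `-∞` the bound `1 - e^{-y} ≤ y` leaves `e^{(s-a)t}`, which is where `a < s` is needed; at
`+∞` the factor `e^{-at}` suffices. -/
lemma stableConst_ne_top {a s : ℝ} (ha : 0 < a) (has : a < s) : stableConst a s ≠ ∞ := by
  refine lintegral_ne_top_of_le_exp (a := s - a) (b := a) (by linarith) ha
    (fun t _ => ?_) (fun t _ => ?_)
  · rw [expNeg_ofReal (Real.exp_pos _).le, ← ENNReal.ofReal_one,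
      ← ENNReal.ofReal_sub _ (Real.exp_pos _).le, ← ENNReal.ofReal_mul (Real.exp_pos _).le]
    refine ENNReal.ofReal_le_ofReal ?_
    have : 1 - Real.exp (-Real.exp (s * t)) ≤ Real.exp (s * t) := by
      linarith [Real.add_one_le_exp (-Real.exp (s * t))]
    calc _ ≤ Real.exp (-a * t) * Real.exp (s * t) := by gcongr
      _ = _ := by rw [← Real.exp_add]; ring_nf
  · calc _ ≤ ENNReal.ofReal (Real.exp (-a * t)) * 1 := by gcongr; exact tsub_le_self
      _ = _ := mul_one _

/-- At `+∞` the crude bound `e^{st} ≥ st` already gives decay `e^{-(s-a)t}`. -/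
lemma gumbelConst_ne_top {a s : ℝ} (ha : 0 < a) (has : a < s) : gumbelConst a s ≠ ∞ := by
  refine lintegral_ne_top_of_le_exp (a := a) (b := s - a) ha (by linarith)
    (fun t _ => ?_) (fun t _ => ?_)
  · rw [neg_neg]
    calc _ ≤ ENNReal.ofReal (Real.exp (a * t)) * 1 := by gcongr; exact expNeg_le_one _
      _ = _ := mul_one _
  · rw [expNeg_ofReal (Real.exp_pos _).le, ← ENNReal.ofReal_mul (Real.exp_pos _).le,
      ← Real.exp_add]
    refine ENNReal.ofReal_le_ofReal (Real.exp_le_exp.2 ?_)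
    linarith [Real.add_one_le_exp (s * t)]

/-- The values `u = 0` and `u = ∞` are included so that a random `u`, not yet known to be finite,
may be substituted. -/
lemma lintegral_exp_mul_one_sub_expNeg {a s : ℝ} (ha : 0 < a) (has : a < s) (u : ℝ≥0∞) :
    ∫⁻ t, ENNReal.ofReal (Real.exp (-a * t)) *
      (1 - expNeg (ENNReal.ofReal (Real.exp (s * t)) * u)) = stableConst a s * u ^ (a / s) := by
  have hs : 0 < s := ha.trans has
  rcases eq_or_ne u 0 with rfl | hu0
  · simp [ENNReal.zero_rpow_of_pos (div_pos ha hs)]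
  rcases eq_or_ne u ∞ with rfl | hu
  · rw [ENNReal.top_rpow_of_pos (div_pos ha hs), ENNReal.mul_top (stableConst_ne_zero a s)]
    refine (lintegral_congr fun t => ?_).trans (lintegral_exp_mul_eq_top ha.ne')
    rw [ENNReal.mul_top (by simp [Real.exp_pos])]
    simp
  · exact lintegral_exp_mul_comp_exp_mul (fun y => 1 - expNeg y) a hs hu0 hu

lemma lintegral_exp_mul_expNeg {a s : ℝ} (ha : 0 < a) (hs : 0 < s) (u : ℝ≥0∞) :
    ∫⁻ t, ENNReal.ofReal (Real.exp (-(-a) * t)) * expNeg (ENNReal.ofReal (Real.exp (s * t)) * u) =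
      gumbelConst a s * u ^ (-a / s) := by
  have has : -a / s < 0 := div_neg_of_neg_of_pos (neg_neg_of_pos ha) hs
  rcases eq_or_ne u 0 with rfl | hu0
  · rw [ENNReal.zero_rpow_of_neg has, ENNReal.mul_top (gumbelConst_ne_zero a s),
      ← lintegral_exp_mul_eq_top (neg_ne_zero.2 ha.ne')]
    simp
  rcases eq_or_ne u ∞ with rfl | hu
  · rw [ENNReal.top_rpow_of_neg has, mul_zero]
    refine (lintegral_congr fun t => ?_).trans lintegral_zero
    rw [ENNReal.mul_top (by simp [Real.exp_pos])]
    simp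
  · exact lintegral_exp_mul_comp_exp_mul expNeg (-a) hs hu0 hu

lemma lintegral_expIntensity_one_sub_expNeg {a s : ℝ} (ha : 0 < a) (has : a < s) (u : ℝ≥0∞) :
    ∫⁻ t, (1 - expNeg (ENNReal.ofReal (Real.exp (s * t)) * u)) ∂(expIntensity a) =
      ENNReal.ofReal a * stableConst a s * u ^ (a / s) := by
  rw [expIntensity, lintegral_withDensity_eq_lintegral_mul _ (by fun_prop) (by fun_prop), mul_assoc,
    ← lintegral_exp_mul_one_sub_expNeg ha has, ← lintegral_const_mul _ (by fun_prop)]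
  refine lintegral_congr fun t => ?_
  rw [Pi.mul_apply, ENNReal.ofReal_mul ha.le, mul_assoc]

/-- The points `exp (s x)` of a Poisson process with intensity `a exp (-a t) dt`, multiplied by
independent marks `u`, have a stable sum that depends on the marks through `E u ^ (a / s)` only. -/
theorem lintegral_expNeg_tsum_exp_mul {Ω E : Type*} [MeasurableSpace Ω] [MeasurableSpace E]
    {P : Measure Ω} [IsProbabilityMeasure P] {γ : Measure E} {a s : ℝ} (ha : 0 < a) (has : a < s)
    {x : ℕ → Ω → ℝ} {g : ℕ → Ω → E} (hx : ∀ n, Measurable (x n)) (hg : ∀ n, Measurable (g n))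
    (hΛ : IsPoissonPointProcess (fun ω => countingOfPoints fun n => x n ω) (expIntensity a) P)
    (hγ : ∀ n, P.map (g n) = γ) (hgg : iIndepFun g P)
    (hxg : IndepFun (fun ω n => x n ω) (fun ω n => g n ω) P)
    {u : E → ℝ≥0∞} (hu : Measurable u) :
    ∫⁻ ω, expNeg (∑' n, ENNReal.ofReal (Real.exp (s * x n ω)) * u (g n ω)) ∂P =
      expNeg (ENNReal.ofReal a * stableConst a s * ∫⁻ y, u y ^ (a / s) ∂γ) := by
  have hγp : IsProbabilityMeasure γ := hγ 0 ▸ Measure.isProbabilityMeasure_map (hg 0).aemeasurable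
  rw [lintegral_expNeg_tsum_of_marked hx hg hΛ hγ hgg hxg
    (f := fun t y => ENNReal.ofReal (Real.exp (s * t)) * u y) (by fun_prop)]
  have hσ : SFinite (expIntensity a) := by unfold expIntensity; infer_instance
  congr 1
  calc _ = ∫⁻ t, ∫⁻ y, (1 - expNeg (ENNReal.ofReal (Real.exp (s * t)) * u y)) ∂γ
        ∂(expIntensity a) := by
        refine lintegral_congr fun t => ?_
        rw [lintegral_sub (by fun_prop)
          ((lintegral_expNeg_le_one γ _).trans_lt ENNReal.one_lt_top).ne
          (ae_of_all _ fun y => expNeg_le_one _)]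
        simp
    _ = ∫⁻ y, ∫⁻ t, (1 - expNeg (ENNReal.ofReal (Real.exp (s * t)) * u y)) ∂(expIntensity a)
        ∂γ := lintegral_lintegral_swap (by fun_prop)
    _ = _ := by
        simp_rw [lintegral_expIntensity_one_sub_expNeg ha has]
        exact lintegral_const_mul _ (by fun_prop)

/-! ### Moments and logarithms of stable variables -/

/-- `S` is a positive random variable with Laplace transform `λ ↦ exp (-K λ ^ a)`. -/
def HasStableLaplace {Ω : Type*} [MeasurableSpace Ω] (S : Ω → ℝ≥0∞) (a : ℝ) (K : ℝ≥0∞)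
    (P : Measure Ω) : Prop :=
  ∀ t : ℝ, ∫⁻ ω, expNeg (ENNReal.ofReal (Real.exp t) * S ω) ∂P =
    expNeg (ENNReal.ofReal (Real.exp (a * t)) * K)

namespace HasStableLaplace

variable {Ω : Type*} [MeasurableSpace Ω] {P : Measure Ω} [IsProbabilityMeasure P]
  {S : Ω → ℝ≥0∞} {a : ℝ} {K : ℝ≥0∞}

/-- The integral `∫ e^{-qt} (1 - E e^{-e^t S}) dt` is evaluated twice: for fixed `S` by scaling with
`s = 1`, and after taking the expectation by scaling with `s = a`. -/
lemma lintegral_rpow (h : HasStableLaplace S a K P) (hS : Measurable S) {q : ℝ} (hq : 0 < q)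
    (hqa : q < a) (ha : a < 1) :
    stableConst q 1 * ∫⁻ ω, S ω ^ q ∂P = stableConst q a * K ^ (q / a) := by
  rw [← lintegral_exp_mul_one_sub_expNeg hq hqa K, ← lintegral_const_mul _ (by fun_prop)]
  have h1 := fun ω => lintegral_exp_mul_one_sub_expNeg hq (hqa.trans ha) (S ω)
  simp_rw [div_one] at h1
  simp_rw [← h1]
  rw [lintegral_lintegral_swap (by fun_prop)]
  refine lintegral_congr fun t => ?_
  rw [lintegral_const_mul _ (by fun_prop), one_mul, ← h t,
    lintegral_sub (by fun_prop) ((lintegral_expNeg_le_one P _).trans_lt ENNReal.one_lt_top).ne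
      (ae_of_all _ fun y => expNeg_le_one _)]
  simp

/-- The same double evaluation, of `∫ e^{qt} E e^{-e^t S} dt`. -/
lemma lintegral_rpow_neg (h : HasStableLaplace S a K P) (hS : Measurable S) {q : ℝ} (hq : 0 < q)
    (ha : 0 < a) :
    gumbelConst q 1 * ∫⁻ ω, S ω ^ (-q) ∂P = gumbelConst q a * K ^ (-q / a) := by
  rw [← lintegral_exp_mul_expNeg hq ha K, ← lintegral_const_mul _ (by fun_prop)]
  have h1 := fun ω => lintegral_exp_mul_expNeg hq one_pos (S ω)
  simp_rw [div_one] at h1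
  simp_rw [← h1]
  rw [lintegral_lintegral_swap (by fun_prop)]
  refine lintegral_congr fun t => ?_
  rw [lintegral_const_mul _ (by fun_prop), one_mul, ← h t]

lemma lintegral_rpow_ne_top (h : HasStableLaplace S a K P) (hS : Measurable S) (ha : 0 < a)
    (ha1 : a < 1) (hK0 : K ≠ 0) (hK : K ≠ ∞) {q : ℝ} (hq : |q| < a) :
    ∫⁻ ω, S ω ^ q ∂P ≠ ∞ := by
  have hKr : ∀ p : ℝ, K ^ p ≠ ∞ := fun p hp => by
    rcases ENNReal.rpow_eq_top_iff.1 hp with h | h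
    · exact hK0 h.1
    · exact hK h.1
  rw [abs_lt] at hq
  rcases lt_trichotomy q 0 with hq0 | rfl | hq0
  · have := h.lintegral_rpow_neg hS (neg_pos.2 hq0) ha
    rw [neg_neg] at this
    intro htop
    rw [htop, ENNReal.mul_top (gumbelConst_ne_zero _ _)] at this
    exact ENNReal.mul_ne_top (gumbelConst_ne_top (neg_pos.2 hq0) (by linarith)) (hKr _) this.symm
  · simp
  · have := h.lintegral_rpow hS hq0 hq.2 ha1
    intro htop
    rw [htop, ENNReal.mul_top (stableConst_ne_zero _ _)] at this
    exact ENNReal.mul_ne_top (stableConst_ne_top hq0 hq.2) (hKr _) this.symm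

/-- A finite positive moment excludes `∞` and a finite negative one excludes `0`. The summability of
the cascade comes from here. -/
lemma ae_ne_zero_and_ne_top (h : HasStableLaplace S a K P) (hS : Measurable S) (ha : 0 < a)
    (ha1 : a < 1) (hK0 : K ≠ 0) (hK : K ≠ ∞) : ∀ᵐ ω ∂P, S ω ≠ 0 ∧ S ω ≠ ∞ := by
  have h1 : |a / 2| < a := by rw [abs_of_pos (by linarith)]; linarith
  have h2 : |-(a / 2)| < a := by rwa [abs_neg]
  filter_upwards [ae_lt_top (by fun_prop) (h.lintegral_rpow_ne_top hS ha ha1 hK0 hK h1),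
    ae_lt_top (by fun_prop) (h.lintegral_rpow_ne_top hS ha ha1 hK0 hK h2)] with ω hω1 hω2
  refine ⟨fun h0 => hω2.ne ?_, fun h0 => hω1.ne ?_⟩
  · rw [h0, ENNReal.zero_rpow_of_neg (by linarith)]
  · rw [h0, ENNReal.top_rpow_of_pos (by linarith)]

lemma ofReal_exp_mul_log_ae_eq (h : HasStableLaplace S a K P) (hS : Measurable S) (ha : 0 < a)
    (ha1 : a < 1) (hK0 : K ≠ 0) (hK : K ≠ ∞) (q : ℝ) :
    (fun ω => ENNReal.ofReal (Real.exp (q * Real.log (S ω).toReal))) =ᵐ[P] fun ω => S ω ^ q := by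
  filter_upwards [h.ae_ne_zero_and_ne_top hS ha ha1 hK0 hK] with ω hω
  have hpos := ENNReal.toReal_pos hω.1 hω.2
  rw [mul_comm, ← Real.rpow_def_of_pos hpos, ← ENNReal.ofReal_rpow_of_pos hpos,
    ENNReal.ofReal_toReal hω.2]

/-- The moments `E S^q`, `|q| < a`, are the exponential moments of `log S`; this makes `log S`
integrable and its moment generating function differentiable at `0`. -/
lemma zero_mem_interior (h : HasStableLaplace S a K P) (hS : Measurable S) (ha : 0 < a)
    (ha1 : a < 1) (hK0 : K ≠ 0) (hK : K ≠ ∞) :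
    0 ∈ interior (integrableExpSet (fun ω => Real.log (S ω).toReal) P) := by
  rw [mem_interior]
  refine ⟨Set.Ioo (-a) a, fun q hq => ?_, isOpen_Ioo, by simp [ha]⟩
  refine ⟨Measurable.aestronglyMeasurable (by fun_prop), ?_⟩
  rw [hasFiniteIntegral_iff_ofReal (ae_of_all _ fun _ => (Real.exp_pos _).le),
    lintegral_congr_ae (h.ofReal_exp_mul_log_ae_eq hS ha ha1 hK0 hK q)]
  exact (h.lintegral_rpow_ne_top hS ha ha1 hK0 hK (abs_lt.2 hq)).lt_top

lemma integrable_log (h : HasStableLaplace S a K P) (hS : Measurable S) (ha : 0 < a)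
    (ha1 : a < 1) (hK0 : K ≠ 0) (hK : K ≠ ∞) :
    Integrable (fun ω => Real.log (S ω).toReal) P :=
  integrable_of_mem_interior_integrableExpSet (h.zero_mem_interior hS ha ha1 hK0 hK)

/-- The moment of order `q` is proportional to the power `q / a` of the scale, with a common nonzero
finite factor that cancels. -/
lemma lintegral_rpow_scale {T : Ω → ℝ≥0∞} {c : ℝ≥0∞}
    (h : HasStableLaplace S a (c ^ a * K) P) (h' : HasStableLaplace T a K P)
    (hS : Measurable S) (hT : Measurable T) (ha : 0 < a) (ha1 : a < 1) (hc : c ≠ ∞)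
    (hK : K ≠ ∞) {q : ℝ} (hq : |q| < a) :
    ∫⁻ ω, S ω ^ q ∂P = c ^ q * ∫⁻ ω, T ω ^ q ∂P := by
  have hcr : ∀ q : ℝ, (c ^ a * K) ^ (q / a) = c ^ q * K ^ (q / a) := fun q => by
    rw [ENNReal.mul_rpow_of_ne_top (ENNReal.rpow_ne_top_of_nonneg ha.le hc) hK, ← ENNReal.rpow_mul,
      mul_div_cancel₀ _ ha.ne']
  rw [abs_lt] at hq
  rcases lt_trichotomy q 0 with hq0 | rfl | hq0
  · have h1 := h.lintegral_rpow_neg hS (neg_pos.2 hq0) ha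
    have h2 := h'.lintegral_rpow_neg hT (neg_pos.2 hq0) ha
    rw [neg_neg] at h1 h2
    rw [hcr, mul_left_comm, ← h2, mul_left_comm] at h1
    exact (ENNReal.mul_right_inj (gumbelConst_ne_zero _ _)
      (gumbelConst_ne_top (neg_pos.2 hq0) (by linarith))).1 h1
  · simp
  · have h1 := h.lintegral_rpow hS hq0 hq.2 ha1
    rw [hcr, mul_left_comm, ← h'.lintegral_rpow hT hq0 hq.2 ha1, mul_left_comm] at h1
    exact (ENNReal.mul_right_inj (stableConst_ne_zero _ _)
      (stableConst_ne_top hq0 (by linarith))).1 h1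

/-- The expected logarithms of two stable random variables differ by the logarithm of the ratio of
their scales. -/
lemma integral_log_eq {T : Ω → ℝ≥0∞} {c : ℝ}
    (h : HasStableLaplace S a (ENNReal.ofReal (Real.exp c) ^ a * K) P)
    (h' : HasStableLaplace T a K P) (hS : Measurable S) (hT : Measurable T) (ha : 0 < a)
    (ha1 : a < 1) (hK0 : K ≠ 0) (hK : K ≠ ∞) :
    ∫ ω, Real.log (S ω).toReal ∂P = c + ∫ ω, Real.log (T ω).toReal ∂P := by
  have hcK0 : ENNReal.ofReal (Real.exp c) ^ a * K ≠ 0 :=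
    mul_ne_zero (by simp [Real.exp_pos, ha]) hK0
  have hcK : ENNReal.ofReal (Real.exp c) ^ a * K ≠ ∞ :=
    ENNReal.mul_ne_top (ENNReal.rpow_ne_top_of_nonneg ha.le ENNReal.ofReal_ne_top) hK
  have iS := h.zero_mem_interior hS ha ha1 hcK0 hcK
  have iT := h'.zero_mem_interior hT ha ha1 hK0 hK
  have hmgf : ∀ q ∈ Set.Ioo (-a) a, mgf (fun ω => Real.log (S ω).toReal) P q =
      Real.exp (q * c) * mgf (fun ω => Real.log (T ω).toReal) P q := by
    intro q hq
    rw [mgf, mgf, integral_eq_lintegral_of_nonneg_ae (ae_of_all _ fun _ => (Real.exp_pos _).le)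
      (Measurable.aestronglyMeasurable (by fun_prop)), integral_eq_lintegral_of_nonneg_ae (ae_of_all _ fun _ => (Real.exp_pos _).le)
      (Measurable.aestronglyMeasurable (by fun_prop)),
      lintegral_congr_ae (h.ofReal_exp_mul_log_ae_eq hS ha ha1 hcK0 hcK q),
      lintegral_congr_ae (h'.ofReal_exp_mul_log_ae_eq hT ha ha1 hK0 hK q),
      h.lintegral_rpow_scale h' hS hT ha ha1 ENNReal.ofReal_ne_top hK (abs_lt.2 hq),
      ENNReal.toReal_mul, ENNReal.ofReal_rpow_of_pos (Real.exp_pos _), ← Real.exp_mul,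
      ENNReal.toReal_ofReal (Real.exp_pos _).le, mul_comm c q]
  have hev : mgf (fun ω => Real.log (S ω).toReal) P =ᶠ[𝓝 0]
      fun q => Real.exp (q * c) * mgf (fun ω => Real.log (T ω).toReal) P q := by
    filter_upwards [Ioo_mem_nhds (neg_lt_zero.2 ha) ha] with q hq using hmgf q hq
  -- Differentiating the identity of moment generating functions at `0` replaces any appeal to
  -- uniqueness of Laplace transforms.
  have hd := hev.deriv_eq
  have hexp : HasDerivAt (fun q : ℝ => Real.exp (q * c)) c 0 := by
    simpa using ((hasDerivAt_id (0 : ℝ)).mul_const c).exp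
  rw [deriv_mgf_zero iS] at hd
  refine (hd.trans (hexp.mul (hasDerivAt_mgf iT)).deriv).trans ?_
  simp

end HasStableLaplace

/-! ### The tree, and averaging over its last level -/

lemma iIndepFun.indepFun_restrict {Ω ι : Type*} {E : ι → Type*} [MeasurableSpace Ω]
    [∀ i, MeasurableSpace (E i)] {P : Measure Ω} {f : ∀ i, Ω → E i} (h : iIndepFun f P)
    (hf : ∀ i, Measurable (f i)) {S T : Set ι} (hST : Disjoint S T) :
    IndepFun (fun ω (i : S) => f i ω) (fun ω (i : T) => f i ω) P := by
  have key : ∀ S : Set ι, MeasurableSpace.comap (fun ω (i : S) => f i ω) MeasurableSpace.pi ≤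
      ⨆ i ∈ S, MeasurableSpace.comap (f i) inferInstance := by
    intro S
    rw [MeasurableSpace.pi, MeasurableSpace.comap_iSup]
    refine iSup_le fun i => ?_
    rw [MeasurableSpace.comap_comp]
    exact le_iSup₂_of_le i.1 i.2 le_rfl
  rw [IndepFun_iff_Indep]
  exact indep_of_indep_of_le (indep_iSup_of_disjoint (fun i => (hf i).comap_le) h hST)
    (key S) (key T)

/-- A sequence of points and a sequence of marks for each internal vertex of the tree. -/
abbrev CascadeConfig (k : ℕ) : Type := InternalVertex k → (ℕ → ℝ) × (ℕ → ℝ)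

/-- The vertex of level `i` on the path from the root to the vertex `β` of level `l`, for `i < l`. -/
def prefixVertex {k l : ℕ} (hl : l ≤ k) (β : Fin l → ℕ) (i : Fin l) : InternalVertex k :=
  ⟨Fin.castLE hl i, fun j => β ⟨j, lt_trans j.2 i.2⟩⟩

/-- The sum of the points along the path from the root to the vertex `β` of level `l`. -/
noncomputable def pathSum {k l : ℕ} (hl : l ≤ k) (β : Fin l → ℕ) (W : CascadeConfig k) : ℝ :=
  ∑ i : Fin l, (W (prefixVertex hl β i)).1 (β i)

/-- The marks along the path from the root to the vertex `β` of level `l`. -/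
def pathMarks {k l : ℕ} (hl : l ≤ k) (β : Fin l → ℕ) (W : CascadeConfig k) : Fin l → ℝ :=
  fun i => (W (prefixVertex hl β i)).2 (β i)

section Path

variable {k l : ℕ}

lemma prefixVertex_snoc_castSucc (hl : l < k) (β : Fin l → ℕ) (n : ℕ) (i : Fin l) :
    prefixVertex hl (Fin.snoc (α := fun _ => ℕ) β n) i.castSucc = prefixVertex hl.le β i := by
  unfold prefixVertex
  refine Sigma.ext rfl (heq_of_eq (funext fun j => ?_))
  exact Fin.snoc_castSucc (α := fun _ => ℕ) n β ⟨j, lt_trans j.2 i.2⟩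

lemma prefixVertex_snoc_last (hl : l < k) (β : Fin l → ℕ) (n : ℕ) :
    prefixVertex hl (Fin.snoc (α := fun _ => ℕ) β n) (Fin.last l) = ⟨⟨l, hl⟩, β⟩ := by
  unfold prefixVertex
  refine Sigma.ext rfl (heq_of_eq (funext fun j => ?_))
  exact Fin.snoc_castSucc (α := fun _ => ℕ) n β j

lemma pathSum_snoc (hl : l < k) (β : Fin l → ℕ) (n : ℕ) (W : CascadeConfig k) :
    pathSum hl (Fin.snoc (α := fun _ => ℕ) β n) W =
      pathSum hl.le β W + (W ⟨⟨l, hl⟩, β⟩).1 n := by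
  rw [pathSum, Fin.sum_univ_castSucc, prefixVertex_snoc_last, Fin.snoc_last]
  simp_rw [prefixVertex_snoc_castSucc, Fin.snoc_castSucc]
  rfl

lemma pathMarks_snoc (hl : l < k) (β : Fin l → ℕ) (n : ℕ) (W : CascadeConfig k) :
    pathMarks hl (Fin.snoc (α := fun _ => ℕ) β n) W =
      Fin.snoc (α := fun _ => ℝ) (pathMarks hl.le β W) ((W ⟨⟨l, hl⟩, β⟩).2 n) := by
  funext i
  refine Fin.lastCases ?_ (fun i => ?_) i
  · rw [pathMarks, prefixVertex_snoc_last, Fin.snoc_last, Fin.snoc_last]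
  · rw [pathMarks, prefixVertex_snoc_castSucc, Fin.snoc_castSucc, Fin.snoc_castSucc]
    rfl

/-- The configuration with all points and marks below level `l` replaced by `0`. -/
def truncateConfig (l : ℕ) (W : CascadeConfig k) : CascadeConfig k :=
  fun v => if (v.1 : ℕ) < l then W v else 0

lemma truncateConfig_prefixVertex (hl : l ≤ k) (β : Fin l → ℕ) (i : Fin l) (W : CascadeConfig k) :
    truncateConfig l W (prefixVertex hl β i) = W (prefixVertex hl β i) :=
  if_pos i.2

lemma pathSum_truncateConfig (hl : l ≤ k) (β : Fin l → ℕ) (W : CascadeConfig k) :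
    pathSum hl β (truncateConfig l W) = pathSum hl β W := by
  simp_rw [pathSum, truncateConfig_prefixVertex]

lemma pathMarks_truncateConfig (hl : l ≤ k) (β : Fin l → ℕ) (W : CascadeConfig k) :
    pathMarks hl β (truncateConfig l W) = pathMarks hl β W := by
  funext i
  rw [pathMarks, truncateConfig_prefixVertex, pathMarks]

@[fun_prop]
lemma measurable_pathSum (hl : l ≤ k) (β : Fin l → ℕ) : Measurable (pathSum hl β) := by
  unfold pathSum
  fun_prop

@[fun_prop]
lemma measurable_pathMarks (hl : l ≤ k) (β : Fin l → ℕ) : Measurable (pathMarks hl β) := by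
  unfold pathMarks
  fun_prop

lemma measurable_snoc {l : ℕ} :
    Measurable fun p : (Fin l → ℝ) × ℝ => Fin.snoc (α := fun _ => ℝ) p.1 p.2 := by
  refine measurable_pi_lambda _ fun i => ?_
  refine Fin.lastCases ?_ (fun i => ?_) i
  · simpa using measurable_snd
  · simp only [Fin.snoc_castSucc]
    fun_prop

lemma tsum_snoc (f : (Fin (l + 1) → ℕ) → ℝ≥0∞) :
    ∑' β, f β = ∑' (β : Fin l → ℕ) (n : ℕ), f (Fin.snoc (α := fun _ => ℕ) β n) := by
  rw [← (Fin.snocEquiv fun _ => ℕ).tsum_eq f, ENNReal.tsum_prod', ENNReal.tsum_comm]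
  rfl

end Path

/-- The random points and marks of a cascade: the families of points and marks attached to the
children of a vertex are independent for different vertices, the points form a Poisson process,
and the marks are independent of the points and independent and identically distributed. -/
structure IsMarkedCascade {Ω : Type*} [MeasurableSpace Ω] {k : ℕ} (m : Fin k → ℝ) (γ : Measure ℝ)
    (W : InternalVertex k → Ω → (ℕ → ℝ) × (ℕ → ℝ)) (P : Measure Ω) : Prop where
  measurable : ∀ v, Measurable (W v)
  isPoisson : ∀ v, IsPoissonPointProcess (fun ω => countingOfPoints (W v ω).1)
    (expIntensity (m v.1)) P
  map_mark : ∀ v n, P.map (fun ω => (W v ω).2 n) = γ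
  iIndepFun_mark : ∀ v, iIndepFun (fun (n : ℕ) ω => (W v ω).2 n) P
  indepFun : ∀ v, IndepFun (fun ω => (W v ω).1) (fun ω => (W v ω).2) P
  iIndepFun : iIndepFun W P

namespace IsMarkedCascade

variable {Ω : Type*} [MeasurableSpace Ω] {k : ℕ} {m : Fin k → ℝ} {γ : Measure ℝ}
    {W : InternalVertex k → Ω → (ℕ → ℝ) × (ℕ → ℝ)} {P : Measure Ω}

/-- Parents of level less than `l` and of level `l` form disjoint families. Truncation keeps the
upper data of type `CascadeConfig k`, so path sums and marks can be read off it. -/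
lemma indepFun_truncateConfig (h : IsMarkedCascade m γ W P) {l : ℕ} (hl : l < k) :
    IndepFun (fun ω => truncateConfig l fun v => W v ω)
      (fun ω (β : Fin l → ℕ) => W ⟨⟨l, hl⟩, β⟩ ω) P := by
  have hd : Disjoint {v : InternalVertex k | (v.1 : ℕ) < l} {v | (v.1 : ℕ) = l} :=
    Set.disjoint_left.2 fun v (h1 : (v.1 : ℕ) < l) (h2 : (v.1 : ℕ) = l) => h1.ne h2
  have h1 := iIndepFun.indepFun_restrict h.iIndepFun h.measurable hd
  let φ : ({v : InternalVertex k | (v.1 : ℕ) < l} → (ℕ → ℝ) × (ℕ → ℝ)) → CascadeConfig k :=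
    fun r v => if hv : (v.1 : ℕ) < l then r ⟨v, hv⟩ else 0
  let χ : ({v : InternalVertex k | (v.1 : ℕ) = l} → (ℕ → ℝ) × (ℕ → ℝ)) →
      (Fin l → ℕ) → (ℕ → ℝ) × (ℕ → ℝ) := fun r β => r ⟨⟨⟨l, hl⟩, β⟩, rfl⟩
  have hφ : Measurable φ := measurable_pi_lambda _ fun v => by
    by_cases hv : (v.1 : ℕ) < l
    · simpa [φ, hv] using measurable_pi_apply _
    · simp [φ, hv]
  have hχ : Measurable χ := measurable_pi_lambda _ fun β => measurable_pi_apply _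
  have h2 := h1.comp hφ hχ
  exact h2

/-- The Laplace transform of a cascade sum after averaging over the last level of the tree. -/
theorem lintegral_expNeg_tsum_succ [IsProbabilityMeasure P] (h : IsMarkedCascade m γ W P) {l : ℕ} (hl : l < k) {s : ℝ}
    (hm : 0 < m ⟨l, hl⟩) (hs : m ⟨l, hl⟩ < s) {f : (Fin (l + 1) → ℝ) → ℝ≥0∞} (hf : Measurable f) :
    ∫⁻ ω, expNeg (∑' β : Fin (l + 1) → ℕ,
        ENNReal.ofReal (Real.exp (s * pathSum hl β fun v => W v ω)) *
          f (pathMarks hl β fun v => W v ω)) ∂P =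
      ∫⁻ ω, expNeg (∑' β : Fin l → ℕ,
        ENNReal.ofReal (Real.exp (m ⟨l, hl⟩ * pathSum hl.le β fun v => W v ω)) *
          (ENNReal.ofReal (m ⟨l, hl⟩) * stableConst (m ⟨l, hl⟩) s *
            ∫⁻ t, f (Fin.snoc (α := fun _ => ℝ) (pathMarks hl.le β fun v => W v ω) t) ^
              (m ⟨l, hl⟩ / s) ∂γ)) ∂P := by
  have hs0 : 0 < s := hm.trans hs
  -- `F β H w` is the contribution of the children of `β`, given the upper data `H` and the block
  -- `w` of points and marks below `β`.
  let F : (Fin l → ℕ) → CascadeConfig k → (ℕ → ℝ) × (ℕ → ℝ) → ℝ≥0∞ := fun β H w =>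
    ∑' n, ENNReal.ofReal (Real.exp (s * w.1 n)) * (ENNReal.ofReal (Real.exp (s * pathSum hl.le β H)) *
      f (Fin.snoc (α := fun _ => ℝ) (pathMarks hl.le β H) (w.2 n)))
  have hF : ∀ β, Measurable (Function.uncurry (F β)) := fun β => by
    refine Measurable.tsum fun n => ?_
    have h1 : Measurable fun p : CascadeConfig k × (ℕ → ℝ) × (ℕ → ℝ) =>
        f (Fin.snoc (α := fun _ => ℝ) (pathMarks hl.le β p.1) (p.2.2 n)) :=
      hf.comp (measurable_snoc.comp (by fun_prop :
        Measurable fun p : CascadeConfig k × (ℕ → ℝ) × (ℕ → ℝ) =>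
          (pathMarks hl.le β p.1, p.2.2 n)))
    fun_prop
  have hH : Measurable fun ω => truncateConfig l fun v => W v ω := by
    refine measurable_pi_lambda _ fun v => ?_
    unfold truncateConfig
    split_ifs
    · exact h.measurable v
    · exact measurable_const
  have hL : ∀ ω, ∑' β : Fin (l + 1) → ℕ,
      ENNReal.ofReal (Real.exp (s * pathSum hl β fun v => W v ω)) *
        f (pathMarks hl β fun v => W v ω) =
      ∑' β, F β (truncateConfig l fun v => W v ω) (W ⟨⟨l, hl⟩, β⟩ ω) := fun ω => by
    rw [tsum_snoc]
    refine tsum_congr fun β => tsum_congr fun n => ?_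
    rw [pathSum_snoc, pathMarks_snoc, pathSum_truncateConfig, pathMarks_truncateConfig, mul_add,
      Real.exp_add, ENNReal.ofReal_mul (Real.exp_pos _).le]
    ring
  simp_rw [hL]
  rw [lintegral_expNeg_tsum_of_indepFun hH (fun β => h.measurable ⟨⟨l, hl⟩, β⟩)
    (h.indepFun_truncateConfig hl) (h.iIndepFun.precomp (g := fun β => ⟨⟨l, hl⟩, β⟩)
      fun β β' hβ => by simpa using hβ) F hF]
  refine lintegral_congr fun ω => congrArg expNeg (tsum_congr fun β => ?_)
  have hx : ∀ n, Measurable fun ω => (W ⟨⟨l, hl⟩, β⟩ ω).1 n := fun n =>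
    (measurable_pi_apply n).comp (h.measurable _).fst
  have hg : ∀ n, Measurable fun ω => (W ⟨⟨l, hl⟩, β⟩ ω).2 n := fun n =>
    (measurable_pi_apply n).comp (h.measurable _).snd
  have hfs : ∀ y : Fin l → ℝ, Measurable fun t => f (Fin.snoc (α := fun _ => ℝ) y t) := fun y =>
    hf.comp (measurable_snoc.comp measurable_prodMk_left)
  -- The upper levels are frozen at `ω`, so the factor of the parent `β` is a constant and can be
  -- absorbed in the function of the mark.
  have := lintegral_expNeg_tsum_exp_mul (u := fun t =>
      ENNReal.ofReal (Real.exp (s * pathSum hl.le β fun v => W v ω)) *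
        f (Fin.snoc (α := fun _ => ℝ) (pathMarks hl.le β fun v => W v ω) t))
    hm hs hx hg (h.isPoisson ⟨⟨l, hl⟩, β⟩) (h.map_mark _) (h.iIndepFun_mark _) (h.indepFun _)
    ((hfs _).const_mul _)
  simp only [F]
  rw [pathSum_truncateConfig, pathMarks_truncateConfig, this, negLog_expNeg]
  -- The power `m / s` from the stable law lowers the exponent of the path sum from `s` to `m`, as
  -- the next level requires.
  have hpow : ENNReal.ofReal (Real.exp (s * pathSum hl.le β fun v => W v ω)) ^ (m ⟨l, hl⟩ / s) =
      ENNReal.ofReal (Real.exp (m ⟨l, hl⟩ * pathSum hl.le β fun v => W v ω)) := by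
    rw [ENNReal.ofReal_rpow_of_pos (Real.exp_pos _), ← Real.exp_mul]
    congr 2
    field_simp
  simp_rw [ENNReal.mul_rpow_of_nonneg _ _ (div_pos hm hs0).le, hpow]
  rw [lintegral_const_mul _ ((hfs _).pow_const _)]
  ring

end IsMarkedCascade

/-! ### The recursion in `[0, ∞]` and the Laplace transform of the cascade -/

/-- The exponential `exp ψ_l` of the Parisi recursion, with values in `[0, ∞]`. -/
noncomputable def expParisi {k : ℕ} (m : Fin k → ℝ) (γ : Measure ℝ) (F : (Fin k → ℝ) → ℝ≥0∞)
    (l : ℕ) (hl : l ≤ k) : (Fin l → ℝ) → ℝ≥0∞ :=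
  Nat.decreasingInduction (motive := fun l _ => (Fin l → ℝ) → ℝ≥0∞)
    (fun l h f y => (∫⁻ t, f (Fin.snoc (α := fun _ => ℝ) y t) ^ m ⟨l, h⟩ ∂γ) ^ (1 / m ⟨l, h⟩)) F hl

section ExpParisi

variable {k : ℕ} {m : Fin k → ℝ} {γ : Measure ℝ} {F : (Fin k → ℝ) → ℝ≥0∞}

lemma expParisi_self : expParisi m γ F k le_rfl = F := by
  simp [expParisi]

lemma expParisi_of_lt {l : ℕ} (hl : l < k) (y : Fin l → ℝ) :
    expParisi m γ F l hl.le y = (∫⁻ t, expParisi m γ F (l + 1) hl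
      (Fin.snoc (α := fun _ => ℝ) y t) ^ m ⟨l, hl⟩ ∂γ) ^ (1 / m ⟨l, hl⟩) := by
  unfold expParisi
  rw [Nat.decreasingInduction_succ_left _ _ hl]

lemma expParisi_rpow (hm : ∀ i, 0 < m i) {l : ℕ} (hl : l < k) (y : Fin l → ℝ) :
    expParisi m γ F l hl.le y ^ m ⟨l, hl⟩ =
      ∫⁻ t, expParisi m γ F (l + 1) hl (Fin.snoc (α := fun _ => ℝ) y t) ^ m ⟨l, hl⟩ ∂γ := by
  rw [expParisi_of_lt, ← ENNReal.rpow_mul, one_div_mul_cancel (hm _).ne', ENNReal.rpow_one]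

lemma measurable_expParisi [SFinite γ] (hF : Measurable F) {l : ℕ} (hl : l ≤ k) :
    Measurable (expParisi m γ F l hl) := by
  induction hl using Nat.decreasingInduction with
  | self => rwa [expParisi_self]
  | of_succ l hl ih =>
    rw [funext (expParisi_of_lt hl)]
    have h1 : Measurable fun p : (Fin l → ℝ) × ℝ => expParisi m γ F (l + 1) hl
      (Fin.snoc (α := fun _ => ℝ) p.1 p.2) ^ m ⟨l, hl⟩ := (ih.comp measurable_snoc).pow_const _
    exact h1.lintegral_prod_right'.pow_const _

/-- Homogeneity of degree one lets the Laplace variable be absorbed in `F` and come out again at the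
root. -/
lemma expParisi_const_mul (hm : ∀ i, 0 < m i) {c : ℝ≥0∞} (hc : c ≠ ∞) {l : ℕ} (hl : l ≤ k)
    (y : Fin l → ℝ) :
    expParisi m γ (fun z => c * F z) l hl y = c * expParisi m γ F l hl y := by
  induction hl using Nat.decreasingInduction with
  | self => rw [expParisi_self, expParisi_self]
  | of_succ l hl ih =>
    rw [expParisi_of_lt hl, expParisi_of_lt hl]
    simp_rw [ih, ENNReal.mul_rpow_of_nonneg _ _ (hm ⟨l, hl⟩).le]
    rw [lintegral_const_mul' _ _ (ENNReal.rpow_ne_top_of_nonneg (hm _).le hc),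
      ENNReal.mul_rpow_of_nonneg _ _ (one_div_pos.2 (hm _)).le, ← ENNReal.rpow_mul,
      mul_one_div_cancel (hm _).ne', ENNReal.rpow_one]

end ExpParisi

/-- The exponent that is attached to level `l` of a tree of depth `k`. -/
noncomputable def levelExponent {k : ℕ} (m : Fin k → ℝ) (l : ℕ) : ℝ :=
  if h : l < k then m ⟨l, h⟩ else 1

/-- The default value `1` at level `k` is the exponent in `e^{z_α}`. The strict inequality makes the
stable constant of each level finite. -/
lemma lt_levelExponent_succ {k : ℕ} {m : Fin k → ℝ} (hm_mono : StrictMono m)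
    (hm_lt : ∀ i, m i < 1) {l : ℕ} (hl : l < k) : m ⟨l, hl⟩ < levelExponent m (l + 1) := by
  unfold levelExponent
  split_ifs with h
  · exact hm_mono (Fin.mk_lt_mk.2 (Nat.lt_succ_self l))
  · exact hm_lt _

/-- The sum over the leaves of the cascade with weights `F`. -/
noncomputable def cascadeTotal {k : ℕ} (F : (Fin k → ℝ) → ℝ≥0∞) (W : CascadeConfig k) :
    ℝ≥0∞ :=
  ∑' α : Fin k → ℕ, ENNReal.ofReal (Real.exp (pathSum le_rfl α W)) * F (pathMarks le_rfl α W)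

namespace IsMarkedCascade

variable {Ω : Type*} [MeasurableSpace Ω] {k : ℕ} {m : Fin k → ℝ} {γ : Measure ℝ}
    {W : InternalVertex k → Ω → (ℕ → ℝ) × (ℕ → ℝ)} {P : Measure Ω} [IsProbabilityMeasure P]

/-- Descending induction removes one level at a time. `C` is chosen before `F`, so it is the same
for the numerator and the denominator of the final ratio. -/
lemma exists_lintegral_expNeg_cascadeTotal [SFinite γ] (h : IsMarkedCascade m γ W P)
    (hm_pos : ∀ i, 0 < m i) (hm_mono : StrictMono m) (hm_lt : ∀ i, m i < 1) {l : ℕ} (hl : l ≤ k) :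
    ∃ C : ℝ≥0∞, C ≠ 0 ∧ C ≠ ∞ ∧ ∀ F : (Fin k → ℝ) → ℝ≥0∞, Measurable F →
      ∫⁻ ω, expNeg (cascadeTotal F fun v => W v ω) ∂P =
        ∫⁻ ω, expNeg (∑' β : Fin l → ℕ,
          ENNReal.ofReal (Real.exp (levelExponent m l * pathSum hl β fun v => W v ω)) *
            (C * expParisi m γ F l hl (pathMarks hl β fun v => W v ω) ^ levelExponent m l)) ∂P := by
  induction hl using Nat.decreasingInduction with
  | self =>
    refine ⟨1, one_ne_zero, ENNReal.one_ne_top, fun F _ => ?_⟩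
    simp [levelExponent, expParisi_self, cascadeTotal]
  | of_succ l hl ih =>
    obtain ⟨C, hC0, hC, ih⟩ := ih
    have hs := lt_levelExponent_succ hm_mono hm_lt hl
    have hm := hm_pos ⟨l, hl⟩
    have hs0 := hm.trans hs
    have hdiv := div_pos hm hs0
    -- The previous constant is part of the function of the marks, hence also raised to the power `m
    -- / s`.
    refine ⟨ENNReal.ofReal (m ⟨l, hl⟩) * stableConst (m ⟨l, hl⟩) (levelExponent m (l + 1)) *
      C ^ (m ⟨l, hl⟩ / levelExponent m (l + 1)), ?_, ?_, fun F hF => ?_⟩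
    · exact mul_ne_zero (mul_ne_zero (by simpa using hm) (stableConst_ne_zero _ _))
        (by simp [hC0, hC])
    · exact ENNReal.mul_ne_top (ENNReal.mul_ne_top ENNReal.ofReal_ne_top (stableConst_ne_top hm hs))
        (ENNReal.rpow_ne_top_of_nonneg hdiv.le hC)
    · rw [ih F hF, h.lintegral_expNeg_tsum_succ hl hm hs (f := fun y =>
        C * expParisi m γ F (l + 1) hl y ^ levelExponent m (l + 1))
        (((measurable_expParisi hF hl).pow_const _).const_mul _)]
      have he : levelExponent m l = m ⟨l, hl⟩ := dif_pos hl
      refine lintegral_congr fun ω => congrArg expNeg (tsum_congr fun β => ?_)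
      rw [he, expParisi_rpow hm_pos hl]
      simp_rw [ENNReal.mul_rpow_of_nonneg _ _ hdiv.le, ← ENNReal.rpow_mul,
        mul_div_cancel₀ _ hs0.ne']
      rw [lintegral_const_mul' _ _ (ENNReal.rpow_ne_top_of_nonneg hdiv.le hC)]
      ring

/-- The total weight of a cascade with independent marks is a stable random variable whose scale is
given by the Parisi recursion. -/
theorem exists_hasStableLaplace [SFinite γ] (h : IsMarkedCascade m γ W P)
    (hm_pos : ∀ i, 0 < m i) (hm_mono : StrictMono m) (hm_lt : ∀ i, m i < 1) (hk : 0 < k) :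
    ∃ C : ℝ≥0∞, C ≠ 0 ∧ C ≠ ∞ ∧ ∀ F : (Fin k → ℝ) → ℝ≥0∞, Measurable F →
      HasStableLaplace (fun ω => cascadeTotal F fun v => W v ω) (m ⟨0, hk⟩)
        (expParisi m γ F 0 hk.le (fun i => i.elim0) ^ m ⟨0, hk⟩ * C) P := by
  obtain ⟨C, hC0, hC, hL⟩ :=
    h.exists_lintegral_expNeg_cascadeTotal hm_pos hm_mono hm_lt (Nat.zero_le k)
  refine ⟨C, hC0, hC, fun F hF t => ?_⟩
  have h1 := hL (fun z => ENNReal.ofReal (Real.exp t) * F z) (hF.const_mul _)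
  have h2 : ∀ ω, cascadeTotal (fun z => ENNReal.ofReal (Real.exp t) * F z) (fun v => W v ω) =
      ENNReal.ofReal (Real.exp t) * cascadeTotal F fun v => W v ω := fun ω => by
    unfold cascadeTotal
    rw [← ENNReal.tsum_mul_left]
    exact tsum_congr fun α => mul_left_comm _ _ _
  simp_rw [h2] at h1
  rw [h1]
  have he : levelExponent m 0 = m ⟨0, hk⟩ := dif_pos hk
  -- At the root the sum has one term, with empty path sum, so the integrand no longer depends on
  -- `ω`.
  have h3 : ∀ ω, (∑' β : Fin 0 → ℕ,
      ENNReal.ofReal (Real.exp (levelExponent m 0 * pathSum hk.le β fun v => W v ω)) *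
        (C * expParisi m γ (fun z => ENNReal.ofReal (Real.exp t) * F z) 0 hk.le
          (pathMarks hk.le β fun v => W v ω) ^ levelExponent m 0)) =
      ENNReal.ofReal (Real.exp (m ⟨0, hk⟩ * t)) *
        (expParisi m γ F 0 hk.le (fun i => i.elim0) ^ m ⟨0, hk⟩ * C) := fun ω => by
    rw [tsum_fintype, Fintype.sum_unique, he, expParisi_const_mul hm_pos ENNReal.ofReal_ne_top,
      ENNReal.mul_rpow_of_nonneg _ _ (hm_pos _).le, ENNReal.ofReal_rpow_of_pos (Real.exp_pos _),
      ← Real.exp_mul, mul_comm t, Subsingleton.elim (pathMarks hk.le _ _) fun i => i.elim0]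
    simp only [pathSum, Finset.univ_eq_empty, Finset.sum_empty, mul_zero, Real.exp_zero,
      ENNReal.ofReal_one, one_mul]
    ring
  simp_rw [h3]
  simp

end IsMarkedCascade

/-! ### Gaussian labels: comparison with the real-valued recursion -/

instance isProbabilityMeasure_stdGaussianVec (l : ℕ) :
    IsProbabilityMeasure (stdGaussianVec l) := by
  unfold stdGaussianVec
  infer_instance

lemma measurePreserving_snoc_stdGaussianVec (l : ℕ) :
    MeasurePreserving (fun p : (Fin l → ℝ) × ℝ => Fin.snoc (α := fun _ => ℝ) p.1 p.2)
      ((stdGaussianVec l).prod (gaussianReal 0 1)) (stdGaussianVec (l + 1)) := by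
  have h1 := (measurePreserving_piFinSuccAbove (fun _ : Fin (l + 1) => gaussianReal 0 1)
    (Fin.last l)).symm
  have h2 : MeasurePreserving Prod.swap ((stdGaussianVec l).prod (gaussianReal 0 1))
      ((gaussianReal 0 1).prod (stdGaussianVec l)) := Measure.measurePreserving_swap
  convert! h1.comp h2 using 1
  funext p
  exact (Fin.insertNth_last' p.2 p.1).symm

lemma lintegral_stdGaussianVec_succ {l : ℕ} {f : (Fin (l + 1) → ℝ) → ℝ≥0∞} (hf : Measurable f) :
    ∫⁻ z, f z ∂(stdGaussianVec (l + 1)) =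
      ∫⁻ y, ∫⁻ t, f (Fin.snoc (α := fun _ => ℝ) y t) ∂(gaussianReal 0 1) ∂(stdGaussianVec l) := by
  rw [← (measurePreserving_snoc_stdGaussianVec l).lintegral_comp hf]
  exact lintegral_prod _ (hf.comp measurable_snoc).aemeasurable

lemma ae_ae_of_ae_stdGaussianVec_succ {l : ℕ} {p : (Fin (l + 1) → ℝ) → Prop}
    (h : ∀ᵐ z ∂(stdGaussianVec (l + 1)), p z) :
    ∀ᵐ y ∂(stdGaussianVec l), ∀ᵐ t ∂(gaussianReal 0 1), p (Fin.snoc (α := fun _ => ℝ) y t) :=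
  Measure.ae_ae_of_ae_prod ((measurePreserving_snoc_stdGaussianVec l).quasiMeasurePreserving.ae h)

lemma lintegral_rpow_ne_top_of_le {α : Type*} [MeasurableSpace α] {μ : Measure α}
    [IsFiniteMeasure μ] {f : α → ℝ≥0∞} {p q : ℝ} (hp : 0 ≤ p) (hpq : p ≤ q)
    (h : ∫⁻ x, f x ^ q ∂μ ≠ ∞) : ∫⁻ x, f x ^ p ∂μ ≠ ∞ := by
  have hle : ∀ x, f x ^ p ≤ 1 + f x ^ q := fun x => by
    rcases le_total (f x) 1 with hx | hx
    · exact (ENNReal.rpow_le_one hx hp).trans le_self_add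
    · exact (ENNReal.rpow_le_rpow_of_exponent_le hx hpq).trans le_add_self
  refine ne_top_of_le_ne_top ?_ (lintegral_mono hle)
  rw [lintegral_add_left measurable_const]
  exact ENNReal.add_ne_top.2 ⟨by simp, h⟩

section Gaussian

variable {k : ℕ} {m : Fin k → ℝ}

lemma expParisi_ne_zero {γ : Measure ℝ} [NeZero γ] [SFinite γ] {F : (Fin k → ℝ) → ℝ≥0∞}
    (hm_pos : ∀ i, 0 < m i) (hF : Measurable F) (hF0 : ∀ y, F y ≠ 0) {l : ℕ} (hl : l ≤ k)
    (y : Fin l → ℝ) : expParisi m γ F l hl y ≠ 0 := by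
  induction hl using Nat.decreasingInduction with
  | self => rw [expParisi_self]; exact hF0 y
  | of_succ l hl ih =>
    intro h0
    have h1 := expParisi_rpow (F := F) (γ := γ) hm_pos hl y
    rw [h0, ENNReal.zero_rpow_of_pos (hm_pos _), eq_comm, lintegral_eq_zero_iff] at h1
    · obtain ⟨t, ht⟩ := h1.exists
      rcases ENNReal.rpow_eq_zero_iff.1 ht with h | h
      · exact ih _ h.1
      · exact (hm_pos _).not_gt h.2
    · exact ((measurable_expParisi hF hl).comp
        (measurable_snoc.comp measurable_prodMk_left)).pow_const _

lemma expParisi_one {γ : Measure ℝ} [IsProbabilityMeasure γ] {l : ℕ} (hl : l ≤ k)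
    (y : Fin l → ℝ) : expParisi m γ (fun _ => 1) l hl y = 1 := by
  induction hl using Nat.decreasingInduction with
  | self => rw [expParisi_self]
  | of_succ l hl ih => rw [expParisi_of_lt hl]; simp [ih]

variable (hm_pos : ∀ i, 0 < m i) (hm_mono : StrictMono m) (hm_lt : ∀ i, m i < 1)

include hm_pos hm_mono hm_lt

/-- Finiteness descends: the moment at level `l + 1` controls the one of smaller order `m ⟨l, hl⟩`,
and the recursion with Tonelli identifies the latter with the moment at level `l`. -/
lemma lintegral_expParisi_rpow_levelExponent_ne_top {F : (Fin k → ℝ) → ℝ≥0∞} (hF : Measurable F)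
    (hFi : ∫⁻ y, F y ∂(stdGaussianVec k) ≠ ∞) {l : ℕ} (hl : l ≤ k) :
    ∫⁻ y, expParisi m (gaussianReal 0 1) F l hl y ^ levelExponent m l ∂(stdGaussianVec l) ≠ ∞ := by
  induction hl using Nat.decreasingInduction with
  | self => simpa [expParisi_self, levelExponent] using hFi
  | of_succ l hl ih =>
    have h1 := lintegral_rpow_ne_top_of_le (hm_pos _).le
      (lt_levelExponent_succ hm_mono hm_lt hl).le ih
    rw [lintegral_stdGaussianVec_succ ((measurable_expParisi hF hl).pow_const _)] at h1
    have he : levelExponent m l = m ⟨l, hl⟩ := dif_pos hl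
    simpa only [he, expParisi_rpow hm_pos hl] using h1

lemma lintegral_expParisi_succ_rpow_ne_top {F : (Fin k → ℝ) → ℝ≥0∞} (hF : Measurable F)
    (hFi : ∫⁻ y, F y ∂(stdGaussianVec k) ≠ ∞) {l : ℕ} (hl : l < k) :
    ∫⁻ y, expParisi m (gaussianReal 0 1) F (l + 1) hl y ^ m ⟨l, hl⟩ ∂(stdGaussianVec (l + 1)) ≠ ∞ :=
  lintegral_rpow_ne_top_of_le (hm_pos _).le (lt_levelExponent_succ hm_mono hm_lt hl).le
    (lintegral_expParisi_rpow_levelExponent_ne_top hm_pos hm_mono hm_lt hF hFi hl)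

/-- Only almost everywhere: where the inner integral diverges, the Bochner integral in `parisiStep`
is `0` by default. Finite moments make such `y` negligible. -/
lemma expParisi_ae_eq {ψ : (Fin k → ℝ) → ℝ} (hψ : Measurable ψ)
    (hψi : ∫⁻ y, ENNReal.ofReal (Real.exp (ψ y)) ∂(stdGaussianVec k) ≠ ∞) {l : ℕ} (hl : l ≤ k) :
    ∀ᵐ y ∂(stdGaussianVec l),
      expParisi m (gaussianReal 0 1) (fun y => ENNReal.ofReal (Real.exp (ψ y))) l hl y =
        ENNReal.ofReal (Real.exp (parisiPsi m ψ l hl y)) := by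
  have hF : Measurable fun y => ENNReal.ofReal (Real.exp (ψ y)) := by fun_prop
  induction hl using Nat.decreasingInduction with
  | self => simp [expParisi_self, parisiPsi_self]
  | of_succ l hl ih =>
    have hm := hm_pos ⟨l, hl⟩
    have h1 := lintegral_expParisi_succ_rpow_ne_top hm_pos hm_mono hm_lt hF hψi hl
    have hmeas := (measurable_expParisi (m := m) (γ := gaussianReal 0 1) hF hl).pow_const (m ⟨l, hl⟩)
    rw [lintegral_stdGaussianVec_succ hmeas] at h1
    have h2 := ae_lt_top ((hmeas.comp measurable_snoc).lintegral_prod_right') h1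
    filter_upwards [h2, ae_ae_of_ae_stdGaussianVec_succ ih] with y hy hy'
    have hmeas' : Measurable fun t => expParisi m (gaussianReal 0 1)
        (fun y => ENNReal.ofReal (Real.exp (ψ y))) (l + 1) hl
          (Fin.snoc (α := fun _ => ℝ) y t) ^ m ⟨l, hl⟩ :=
      hmeas.comp (measurable_snoc.comp measurable_prodMk_left)
    have hint : ∫ t, Real.exp (m ⟨l, hl⟩ * parisiPsi m ψ (l + 1) hl
        (Fin.snoc (α := fun _ => ℝ) y t)) ∂(gaussianReal 0 1) =
        (expParisi m (gaussianReal 0 1) (fun y => ENNReal.ofReal (Real.exp (ψ y))) l hl.le y ^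
          m ⟨l, hl⟩).toReal := by
      rw [expParisi_rpow hm_pos hl, ← integral_toReal hmeas'.aemeasurable
        (ae_lt_top hmeas' hy.ne)]
      refine integral_congr_ae ?_
      filter_upwards [hy'] with t ht
      rw [ht, ENNReal.ofReal_rpow_of_pos (Real.exp_pos _), ← Real.exp_mul,
        ENNReal.toReal_ofReal (Real.exp_pos _).le, mul_comm]
    have hne0 := expParisi_ne_zero (γ := gaussianReal 0 1) hm_pos hF
      (fun y => by simp [Real.exp_pos]) hl.le y
    have hnet : expParisi m (gaussianReal 0 1) (fun y => ENNReal.ofReal (Real.exp (ψ y)))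
        l hl.le y ≠ ∞ := by
      intro htop
      have := expParisi_rpow (γ := gaussianReal 0 1)
        (F := fun y => ENNReal.ofReal (Real.exp (ψ y))) hm_pos hl y
      rw [htop, ENNReal.top_rpow_of_pos hm] at this
      exact hy.ne this.symm
    rw [parisiPsi_of_lt m ψ l hl, parisiStep, hint, ← ENNReal.toReal_rpow,
      Real.log_rpow (ENNReal.toReal_pos hne0 hnet), ← mul_assoc, one_div_mul_cancel hm.ne', one_mul,
      Real.exp_log (ENNReal.toReal_pos hne0 hnet), ENNReal.ofReal_toReal hnet]

lemma integrable_exp_mul_parisiPsi {ψ : (Fin k → ℝ) → ℝ} (hψ : Measurable ψ)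
    (hψi : ∫⁻ y, ENNReal.ofReal (Real.exp (ψ y)) ∂(stdGaussianVec k) ≠ ∞) {l : ℕ} (hl : l < k) :
    Integrable (fun y => Real.exp (m ⟨l, hl⟩ * parisiPsi m ψ (l + 1) hl y))
      (stdGaussianVec (l + 1)) := by
  have hF : Measurable fun y => ENNReal.ofReal (Real.exp (ψ y)) := by fun_prop
  refine (integrable_toReal_of_lintegral_ne_top
    ((measurable_expParisi (m := m) (γ := gaussianReal 0 1) hF hl).pow_const
      (m ⟨l, hl⟩)).aemeasurable
    (lintegral_expParisi_succ_rpow_ne_top hm_pos hm_mono hm_lt hF hψi hl)).congr ?_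
  filter_upwards [expParisi_ae_eq hm_pos hm_mono hm_lt hψ hψi hl] with y hy
  rw [hy, ENNReal.ofReal_rpow_of_pos (Real.exp_pos _), ← Real.exp_mul,
    ENNReal.toReal_ofReal (Real.exp_pos _).le, mul_comm]

/-- `Fin 0 → ℝ` is a single point, so almost everywhere means everywhere. -/
lemma expParisi_zero_eq {ψ : (Fin k → ℝ) → ℝ} (hψ : Measurable ψ)
    (hψi : ∫⁻ y, ENNReal.ofReal (Real.exp (ψ y)) ∂(stdGaussianVec k) ≠ ∞) (y : Fin 0 → ℝ) :
    expParisi m (gaussianReal 0 1) (fun y => ENNReal.ofReal (Real.exp (ψ y))) 0 (Nat.zero_le k) y =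
      ENNReal.ofReal (Real.exp (parisiPsi m ψ 0 (Nat.zero_le k) y)) := by
  obtain ⟨z, hz⟩ := (expParisi_ae_eq hm_pos hm_mono hm_lt hψ hψi (Nat.zero_le k)).exists
  rwa [Subsingleton.elim y z]

end Gaussian

/-! ### Fresh marks on a product space -/

lemma iIndepFun.comp_measurePreserving {Ω Ω' ι : Type*} {E : ι → Type*} [MeasurableSpace Ω]
    [MeasurableSpace Ω'] [∀ i, MeasurableSpace (E i)] {P : Measure Ω} {P' : Measure Ω'}
    {X : ∀ i, Ω → E i} (h : iIndepFun X P) (hX : ∀ i, Measurable (X i)) {φ : Ω' → Ω}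
    (hφ : MeasurePreserving φ P' P) : iIndepFun (fun i ω => X i (φ ω)) P' := by
  rw [iIndepFun_iff_measure_inter_preimage_eq_mul] at h ⊢
  intro S s hs
  have h1 : ∀ i ∈ S, P' ((fun ω => X i (φ ω)) ⁻¹' s i) = P (X i ⁻¹' s i) := fun i hi =>
    hφ.measure_preimage (hX i (hs i hi)).nullMeasurableSet
  rw [Finset.prod_congr rfl h1, ← h S hs,
    ← hφ.measure_preimage (S.measurableSet_biInter fun i hi => hX i (hs i hi)).nullMeasurableSet]
  simp only [Set.preimage_iInter]
  rfl

/-- Pairs of members of two independent families on the factors of a product space are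
independent. -/
lemma iIndepFun.prodMk_prod {Ω Ω' ι A B : Type*} [MeasurableSpace Ω]
    [MeasurableSpace Ω'] [MeasurableSpace A] [MeasurableSpace B] {P : Measure Ω} {Q : Measure Ω'}
    {X : ι → Ω → A} {Y : ι → Ω' → B} (hX : iIndepFun X P) (hY : iIndepFun Y Q)
    (mX : ∀ i, Measurable (X i)) (mY : ∀ i, Measurable (Y i)) :
    iIndepFun (fun i (p : Ω × Ω') => (X i p.1, Y i p.2)) (P.prod Q) := by
  have hP := hX.isProbabilityMeasure
  have hQ := hY.isProbabilityMeasure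
  have mZ : ∀ i, Measurable fun p : Ω × Ω' => (X i p.1, Y i p.2) := fun i =>
    ((mX i).comp measurable_fst).prodMk ((mY i).comp measurable_snd)
  refine iIndepSets.iIndep (fun i => (mZ i).comap_le)
    (fun i => Set.preimage (fun p : Ω × Ω' => (X i p.1, Y i p.2)) ''
      Set.image2 (· ×ˢ ·) {s : Set A | MeasurableSet s} {t : Set B | MeasurableSet t})
    (fun i => isPiSystem_prod.comap _)
    (fun i => by rw [← MeasurableSpace.comap_generateFrom, generateFrom_prod]) ?_
  rw [iIndepSets_iff]
  intro S f hf
  have hf' : ∀ i, ∃ s : Set A, ∃ t : Set B, i ∈ S → MeasurableSet s ∧ MeasurableSet t ∧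
      f i = (X i ⁻¹' s) ×ˢ (Y i ⁻¹' t) := by
    intro i
    by_cases hi : i ∈ S
    · obtain ⟨_, ⟨s, hs, t, ht, rfl⟩, hst⟩ := hf i hi
      exact ⟨s, t, fun _ => ⟨hs, ht, hst.symm⟩⟩
    · exact ⟨∅, ∅, fun h => absurd h hi⟩
  choose s t hst using hf'
  have h1 : ⋂ i ∈ S, f i = (⋂ i ∈ S, X i ⁻¹' s i) ×ˢ (⋂ i ∈ S, Y i ⁻¹' t i) := by
    rw [Set.iInter₂_congr fun i hi => (hst i hi).2.2]
    ext p
    simp only [Set.mem_iInter, Set.mem_prod]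
    exact ⟨fun h => ⟨fun i hi => (h i hi).1, fun i hi => (h i hi).2⟩,
      fun h i hi => ⟨h.1 i hi, h.2 i hi⟩⟩
  rw [h1, Measure.prod_prod, hX.measure_inter_preimage_eq_mul S fun i hi => (hst i hi).1,
    hY.measure_inter_preimage_eq_mul S fun i hi => (hst i hi).2.1, ← Finset.prod_mul_distrib]
  refine Finset.prod_congr rfl fun i hi => ?_
  rw [(hst i hi).2.2, Measure.prod_prod]

lemma IsPoissonPointProcess.comp_measurePreserving {Ω Ω' E : Type*} [MeasurableSpace Ω]
    [MeasurableSpace Ω'] [MeasurableSpace E] {P : Measure Ω} {P' : Measure Ω'}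
    {N : Ω → Measure E} {Λ : Measure E} (h : IsPoissonPointProcess N Λ P) (hN : Measurable N)
    {φ : Ω' → Ω} (hφ : MeasurePreserving φ P' P) :
    IsPoissonPointProcess (fun ω => N (φ ω)) Λ P' where
  hasLaw_poisson B hB hΛ := (h.hasLaw_poisson B hB hΛ).comp ⟨hφ.aemeasurable, hφ.map_eq⟩
  ae_eq_top B hB hΛ := hφ.quasiMeasurePreserving.ae (h.ae_eq_top B hB hΛ)
  iIndepFun_of_disjoint n B hB hd :=
    _root_.iIndepFun.comp_measurePreserving (h.iIndepFun_of_disjoint n B hB hd)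
      (fun i => (Measure.measurable_coe (hB i)).comp hN) hφ

section Canonical

variable {k : ℕ}

/-- The law of independent marks with law `γ` at all the non-root vertices, grouped by parents. -/
noncomputable def marksLaw (k : ℕ) (γ : Measure ℝ) : Measure (InternalVertex k → ℕ → ℝ) :=
  Measure.infinitePi fun _ => Measure.infinitePi fun _ => γ

instance (γ : Measure ℝ) [IsProbabilityMeasure γ] : IsProbabilityMeasure (marksLaw k γ) := by
  unfold marksLaw
  infer_instance

/-- The parent of a non-root vertex. -/
def NonRootVertex.parent (w : NonRootVertex k) : InternalVertex k :=
  ⟨w.1, Fin.init (α := fun _ => ℕ) w.2⟩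

/-- The index of a non-root vertex among its siblings. -/
def NonRootVertex.index (w : NonRootVertex k) : ℕ := w.2 (Fin.last _)

lemma child_parent_index (w : NonRootVertex k) : w.parent.child w.index = w :=
  Sigma.ext rfl (heq_of_eq (Fin.snoc_init_self (α := fun _ => ℕ) w.2))

lemma child_prefixVertex (α : Fin k → ℕ) (i : Fin k) :
    (prefixVertex le_rfl α i).child (α i) = pathVertex α i :=
  child_parent_index (pathVertex α i)

/-- The marks grouped by parents, as a family indexed by the non-root vertices. -/
def ungroupMarks (y : InternalVertex k → ℕ → ℝ) (w : NonRootVertex k) : ℝ := y w.parent w.index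

lemma measurable_ungroupMarks : Measurable (ungroupMarks (k := k)) := by
  unfold ungroupMarks
  fun_prop

/-- A vertex is determined by its parent and its index, so ungrouping is an injective reindexing of
an i.i.d. family. -/
lemma map_ungroupMarks (γ : Measure ℝ) [IsProbabilityMeasure γ] :
    (marksLaw k γ).map ungroupMarks = Measure.infinitePi fun _ => γ := by
  have h1 := iIndepFun_uncurry_infinitePi' (ι := InternalVertex k) (κ := ℕ)
    (X := fun _ _ (t : ℝ) => t) (fun _ _ => γ) (fun _ _ => measurable_id)
  have h2 := h1.precomp (g := fun w : NonRootVertex k => (w.parent, w.index)) fun w w' hw => by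
    rw [Prod.mk.injEq] at hw
    rw [← child_parent_index w, ← child_parent_index w', hw.1, hw.2]
  rw [iIndepFun_iff_map_fun_eq_infinitePi_map (fun w => by fun_prop)] at h2
  refine h2.trans (congrArg _ (funext fun w => ?_))
  have h3 := (measurePreserving_eval_infinitePi (fun _ : ℕ => γ) w.index).comp
    (measurePreserving_eval_infinitePi
      (fun _ : InternalVertex k => Measure.infinitePi fun _ : ℕ => γ) w.parent)
  exact h3.map_eq

/-- The points of a cascade together with marks on an independent space. -/
def markedConfig {Ω : Type*} (x : NonRootVertex k → Ω → ℝ) (v : InternalVertex k)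
    (p : Ω × (InternalVertex k → ℕ → ℝ)) : (ℕ → ℝ) × (ℕ → ℝ) :=
  (fun n => x (v.child n) p.1, p.2 v)

lemma pathSum_markedConfig {Ω : Type*} (x : NonRootVertex k → Ω → ℝ) (α : Fin k → ℕ)
    (p : Ω × (InternalVertex k → ℕ → ℝ)) :
    pathSum le_rfl α (fun v => markedConfig x v p) = cascadeSum x α p.1 := by
  unfold pathSum cascadeSum markedConfig
  simp_rw [child_prefixVertex]

lemma pathMarks_markedConfig {Ω : Type*} (x : NonRootVertex k → Ω → ℝ) (α : Fin k → ℕ)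
    (p : Ω × (InternalVertex k → ℕ → ℝ)) :
    pathMarks le_rfl α (fun v => markedConfig x v p) =
      fun i => ungroupMarks p.2 (pathVertex α i) := rfl

/-- Marks on a separate factor are independent of the points themselves, which is not assumed of the
labels `g`. -/
lemma isMarkedCascade_markedConfig {Ω : Type*} [MeasurableSpace Ω] {P : Measure Ω}
    [IsProbabilityMeasure P] {m : Fin k → ℝ} {x : NonRootVertex k → Ω → ℝ}
    (hx : IsPoissonCascade m x P) (γ : Measure ℝ) [IsProbabilityMeasure γ] :
    IsMarkedCascade m γ (markedConfig x) (P.prod (marksLaw k γ)) := by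
  have hxm : ∀ v : InternalVertex k, Measurable fun (ω : Ω) (n : ℕ) => x (v.child n) ω :=
    fun v => measurable_pi_lambda _ fun n => hx.measurable _
  have hev := fun v : InternalVertex k => measurePreserving_eval_infinitePi
    (fun _ : InternalVertex k => Measure.infinitePi fun _ : ℕ => γ) v
  have hsnd : MeasurePreserving Prod.snd (P.prod (marksLaw k γ)) (marksLaw k γ) :=
    measurePreserving_snd
  refine ⟨fun v => ?_, fun v => ?_, fun v n => ?_, fun v => ?_, fun v => ?_, ?_⟩
  · exact ((hxm v).comp measurable_fst).prodMk ((measurable_pi_apply v).comp measurable_snd)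
  · exact (hx.isPoisson v).comp_measurePreserving
      (measurable_countingOfPoints fun n => hx.measurable _) measurePreserving_fst
  · exact (((measurePreserving_eval_infinitePi (fun _ : ℕ => γ) n).comp (hev v)).comp hsnd).map_eq
  · exact iIndepFun.comp_measurePreserving
      (iIndepFun_infinitePi (P := fun _ : ℕ => γ) (X := fun _ t => t) fun _ => measurable_id)
      (fun n => measurable_pi_apply n) ((hev v).comp hsnd)
  · exact indepFun_prod (hxm v) (measurable_pi_apply v)
  · exact iIndepFun.prodMk_prod hx.iIndepFun_children
      (iIndepFun_infinitePi (P := fun _ : InternalVertex k => Measure.infinitePi fun _ : ℕ => γ)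
        (X := fun _ y => y) fun _ => measurable_id) hxm fun v => measurable_pi_apply v

end Canonical

/-! ### Ruelle weights, transfer of law and conclusion -/

/-- The sum of `n α * exp (ψ (y along the path to α))` over the leaves, with values in `[0, ∞]`. -/
noncomputable def leafSum {k : ℕ} (ψ : (Fin k → ℝ) → ℝ)
    (q : ((Fin k → ℕ) → ℝ) × (NonRootVertex k → ℝ)) : ℝ≥0∞ :=
  ∑' α : Fin k → ℕ, ENNReal.ofReal (q.1 α * Real.exp (ψ fun i => q.2 (pathVertex α i)))

lemma measurable_leafSum {k : ℕ} {ψ : (Fin k → ℝ) → ℝ} (hψ : Measurable ψ) :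
    Measurable (leafSum ψ) := by
  refine Measurable.tsum fun α => ?_
  fun_prop

lemma measurable_cascadeTotal {k : ℕ} {F : (Fin k → ℝ) → ℝ≥0∞} (hF : Measurable F) :
    Measurable (cascadeTotal F) := by
  refine Measurable.tsum fun α => ?_
  fun_prop

lemma ruelleWeight_nonneg {Ω : Type*} {k : ℕ} (x : NonRootVertex k → Ω → ℝ) (α : Fin k → ℕ)
    (ω : Ω) : 0 ≤ ruelleWeight x α ω :=
  div_nonneg (Real.exp_pos _).le (tsum_nonneg fun _ => (Real.exp_pos _).le)

lemma measurable_ruelleWeight {Ω : Type*} [MeasurableSpace Ω] {k : ℕ} {x : NonRootVertex k → Ω → ℝ}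
    (hx : ∀ v, Measurable (x v)) (α : Fin k → ℕ) : Measurable (ruelleWeight x α) := by
  have h : ∀ α, Measurable (cascadeSum x α) := fun α => by
    unfold cascadeSum
    fun_prop
  exact (h α).exp.div (Measurable.tsum fun β => (h β).exp)

/-- The joint law of the weights and the labels is the same as that of the weights and independent
marks on the product space. -/
lemma map_ruelleWeight_labels {Ω : Type*} [MeasurableSpace Ω] {P : Measure Ω}
    [IsProbabilityMeasure P] {k : ℕ} {x g : NonRootVertex k → Ω → ℝ} {γ : Measure ℝ}
    [IsProbabilityMeasure γ] (hx : ∀ v, Measurable (x v)) (hg : ∀ v, HasLaw (g v) γ P)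
    (hgi : iIndepFun g P)
    (hxg : IndepFun (fun ω α => ruelleWeight x α ω) (fun ω v => g v ω) P) :
    P.map (fun ω => ((fun α => ruelleWeight x α ω), fun v => g v ω)) =
      (P.prod (marksLaw k γ)).map
        (fun p => ((fun α => ruelleWeight x α p.1), ungroupMarks p.2)) := by
  have mν : Measurable fun ω α => ruelleWeight x α ω :=
    measurable_pi_lambda _ fun α => measurable_ruelleWeight hx α
  have mg : AEMeasurable (fun ω v => g v ω) P := aemeasurable_pi_iff.2 fun v => (hg v).aemeasurable
  rw [(indepFun_iff_map_prod_eq_prod_map_map mν.aemeasurable mg).1 hxg,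
    (hgi.hasLaw_infinitePi hg mg).map_eq, ← map_ungroupMarks γ,
    Measure.map_prod_map _ _ mν measurable_ungroupMarks]
  rfl

lemma tsum_ruelleWeight_mul {Ω : Type*} {k : ℕ} (x g : NonRootVertex k → Ω → ℝ)
    (ψ : (Fin k → ℝ) → ℝ) (ω : Ω) :
    ∑' α : Fin k → ℕ, ruelleWeight x α ω * Real.exp (ψ (pathLabels g α ω)) =
      (leafSum ψ (fun α => ruelleWeight x α ω, fun v => g v ω)).toReal := by
  rw [leafSum, ENNReal.tsum_toReal_eq fun _ => ENNReal.ofReal_ne_top]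
  refine tsum_congr fun α => ?_
  rw [ENNReal.toReal_ofReal (mul_nonneg (ruelleWeight_nonneg x α ω) (Real.exp_pos _).le)]
  rfl

lemma summable_ruelleWeight_mul {Ω : Type*} {k : ℕ} {x g : NonRootVertex k → Ω → ℝ}
    {ψ : (Fin k → ℝ) → ℝ} {ω : Ω}
    (h : leafSum ψ (fun α => ruelleWeight x α ω, fun v => g v ω) ≠ ∞) :
    Summable fun α : Fin k → ℕ => ruelleWeight x α ω * Real.exp (ψ (pathLabels g α ω)) := by
  refine (ENNReal.summable_toReal h).congr fun α => ?_
  rw [ENNReal.toReal_ofReal (mul_nonneg (ruelleWeight_nonneg x α ω) (Real.exp_pos _).le)]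
  rfl

lemma cascadeTotal_one_markedConfig {Ω : Type*} {k : ℕ} (x : NonRootVertex k → Ω → ℝ)
    (p : Ω × (InternalVertex k → ℕ → ℝ)) :
    cascadeTotal (fun _ => 1) (fun v => markedConfig x v p) =
      ∑' α, ENNReal.ofReal (Real.exp (cascadeSum x α p.1)) := by
  simp_rw [cascadeTotal, pathSum_markedConfig, mul_one]

/-- The real sum in the denominator of the weights would be `0` if it diverged; finiteness of the
total makes it the true normalization. -/
lemma leafSum_ruelleWeight {Ω : Type*} {k : ℕ} (x : NonRootVertex k → Ω → ℝ)
    (ψ : (Fin k → ℝ) → ℝ) (p : Ω × (InternalVertex k → ℕ → ℝ))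
    (h0 : cascadeTotal (fun _ => 1) (fun v => markedConfig x v p) ≠ 0)
    (h : cascadeTotal (fun _ => 1) (fun v => markedConfig x v p) ≠ ∞) :
    leafSum ψ (fun α => ruelleWeight x α p.1, ungroupMarks p.2) =
      cascadeTotal (fun y => ENNReal.ofReal (Real.exp (ψ y))) (fun v => markedConfig x v p) /
        cascadeTotal (fun _ => 1) (fun v => markedConfig x v p) := by
  have hT : ∑' β, Real.exp (cascadeSum x β p.1) =
      (cascadeTotal (fun _ => 1) (fun v => markedConfig x v p)).toReal := by
    rw [cascadeTotal_one_markedConfig, ENNReal.tsum_toReal_eq fun _ => ENNReal.ofReal_ne_top]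
    simp_rw [ENNReal.toReal_ofReal (Real.exp_pos _).le]
  rw [leafSum, cascadeTotal, div_eq_mul_inv, ← ENNReal.tsum_mul_right]
  refine tsum_congr fun α => ?_
  dsimp only
  rw [ruelleWeight, hT, pathSum_markedConfig, pathMarks_markedConfig,
    ENNReal.ofReal_mul (by positivity), ENNReal.ofReal_div_of_pos (ENNReal.toReal_pos h0 h),
    ENNReal.ofReal_toReal h, div_eq_mul_inv]
  ring

theorem mainTheorem4 {Ω : Type*} [MeasurableSpace Ω] (P : Measure Ω) [IsProbabilityMeasure P]
    (k : ℕ) (hk : 1 ≤ k)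
    -- the parameters `0 < m₁ < ⋯ < m_k < 1`; `m i` is the parameter of level `i + 1`
    (m : Fin k → ℝ) (hm_pos : ∀ i, 0 < m i) (hm_mono : StrictMono m) (hm_lt : ∀ i, m i < 1)
    -- the Poisson points that define the Ruelle probability cascade
    (x : NonRootVertex k → Ω → ℝ) (hx : IsPoissonCascade m x P)
    -- the independent standard Gaussian labels, independent of the weights of the cascade
    (g : NonRootVertex k → Ω → ℝ) (hg_law : ∀ v, HasLaw (g v) (gaussianReal 0 1) P)
    (hg_indep : iIndepFun g P)
    (hxg : IndepFun (fun ω α => ruelleWeight x α ω) (fun ω v => g v ω) P)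
    (ψ : (Fin k → ℝ) → ℝ) (hψ_meas : Measurable ψ)
    (hψ : Integrable (fun y => Real.exp (ψ y)) (stdGaussianVec k)) :
    -- the cascade, the recursion and the random sum are well defined
    (∀ᵐ ω ∂P, Summable fun α : Fin k → ℕ => Real.exp (cascadeSum x α ω)) ∧
    (∀ (l : ℕ) (hl : l < k),
      Integrable (fun y => Real.exp (m ⟨l, hl⟩ * parisiPsi m ψ (l + 1) hl y))
        (stdGaussianVec (l + 1))) ∧
    (∀ᵐ ω ∂P, Summable fun α : Fin k → ℕ =>
      ruelleWeight x α ω * Real.exp (ψ (pathLabels g α ω))) ∧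
    Integrable (fun ω => Real.log (∑' α : Fin k → ℕ,
      ruelleWeight x α ω * Real.exp (ψ (pathLabels g α ω)))) P ∧
    -- the representation of `ψ₀`
    parisiPsi m ψ 0 (Nat.zero_le k) (fun i => i.elim0) =
      ∫ ω, Real.log (∑' α : Fin k → ℕ,
        ruelleWeight x α ω * Real.exp (ψ (pathLabels g α ω))) ∂P := by
  have hk0 : 0 < k := hk
  have hψi : ∫⁻ y, ENNReal.ofReal (Real.exp (ψ y)) ∂(stdGaussianVec k) ≠ ∞ :=
    hψ.lintegral_lt_top.ne
  have hF : Measurable fun y => ENNReal.ofReal (Real.exp (ψ y)) := by fun_prop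
  set γ : Measure ℝ := gaussianReal 0 1 with hγ
  set Q := P.prod (marksLaw k γ) with hQ
  have hW := isMarkedCascade_markedConfig hx γ
  have mW : Measurable fun p v => markedConfig x v p := measurable_pi_lambda _ hW.measurable
  obtain ⟨C, hC0, hC, hL⟩ := hW.exists_hasStableLaplace hm_pos hm_mono hm_lt hk0
  set S : Ω × (InternalVertex k → ℕ → ℝ) → ℝ≥0∞ := fun p =>
    cascadeTotal (fun y => ENNReal.ofReal (Real.exp (ψ y))) fun v => markedConfig x v p with hS
  set T : Ω × (InternalVertex k → ℕ → ℝ) → ℝ≥0∞ := fun p =>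
    cascadeTotal (fun _ => 1) fun v => markedConfig x v p with hT
  have mS : Measurable S := (measurable_cascadeTotal hF).comp mW
  have mT : Measurable T := (measurable_cascadeTotal measurable_const).comp mW
  have hm0 := hm_pos ⟨0, hk0⟩
  have hm1 := hm_lt ⟨0, hk0⟩
  set c := parisiPsi m ψ 0 (Nat.zero_le k) (fun i => i.elim0) with hc
  have lS : HasStableLaplace S (m ⟨0, hk0⟩) (ENNReal.ofReal (Real.exp c) ^ m ⟨0, hk0⟩ * C) Q := by
    have := hL _ hF
    rwa [expParisi_zero_eq hm_pos hm_mono hm_lt hψ_meas hψi] at this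
  have lT : HasStableLaplace T (m ⟨0, hk0⟩) C Q := by
    have := hL (fun _ => 1) measurable_const
    rwa [expParisi_one, ENNReal.one_rpow, one_mul] at this
  have hcC0 : ENNReal.ofReal (Real.exp c) ^ m ⟨0, hk0⟩ * C ≠ 0 :=
    mul_ne_zero (by simp [Real.exp_pos, hm0]) hC0
  have hcC : ENNReal.ofReal (Real.exp c) ^ m ⟨0, hk0⟩ * C ≠ ∞ :=
    ENNReal.mul_ne_top (ENNReal.rpow_ne_top_of_nonneg hm0.le ENNReal.ofReal_ne_top) hC
  have aS := lS.ae_ne_zero_and_ne_top mS hm0 hm1 hcC0 hcC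
  have aT := lT.ae_ne_zero_and_ne_top mT hm0 hm1 hC0 hC
  have iS := lS.integrable_log mS hm0 hm1 hcC0 hcC
  have iT := lT.integrable_log mT hm0 hm1 hC0 hC
  have hlog := lS.integral_log_eq lT mS mT hm0 hm1 hC0 hC
  have mΘ' : Measurable fun p : Ω × (InternalVertex k → ℕ → ℝ) =>
      ((fun α => ruelleWeight x α p.1), ungroupMarks p.2) :=
    ((measurable_pi_lambda _ fun α => measurable_ruelleWeight hx.measurable α).comp
      measurable_fst).prodMk (measurable_ungroupMarks.comp measurable_snd)
  have mΘ : AEMeasurable (fun ω => ((fun α => ruelleWeight x α ω), fun v => g v ω)) P :=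
    (measurable_pi_lambda _ fun α => measurable_ruelleWeight hx.measurable α).aemeasurable.prodMk
      (aemeasurable_pi_iff.2 fun v => (hg_law v).aemeasurable)
  have hmap := map_ruelleWeight_labels hx.measurable hg_law hg_indep hxg
  have mR := measurable_leafSum hψ_meas
  have mlog : Measurable fun q => Real.log (leafSum ψ q).toReal := by fun_prop
  have hR : ∀ᵐ p ∂Q, leafSum ψ (fun α => ruelleWeight x α p.1, ungroupMarks p.2) = S p / T p := by
    filter_upwards [aT] with p hp using leafSum_ruelleWeight x ψ p hp.1 hp.2
  -- Since `S` and `T` are almost surely in `(0, ∞)`, the logarithm of the ratio splits, and its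
  -- integrability follows from that of `log S` and `log T`.
  have hlogR : (fun p => Real.log (S p).toReal - Real.log (T p).toReal) =ᵐ[Q]
      fun p => Real.log (leafSum ψ (fun α => ruelleWeight x α p.1, ungroupMarks p.2)).toReal := by
    filter_upwards [aS, aT, hR] with p hpS hpT hp
    rw [hp, ENNReal.toReal_div, Real.log_div (ENNReal.toReal_pos hpS.1 hpS.2).ne'
      (ENNReal.toReal_pos hpT.1 hpT.2).ne']
  simp_rw [tsum_ruelleWeight_mul]
  refine ⟨?_, fun l hl => integrable_exp_mul_parisiPsi hm_pos hm_mono hm_lt hψ_meas hψi hl,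
    ?_, ?_, ?_⟩
  -- `T` does not depend on the marks, so one good mark configuration for each `ω` suffices.
  · filter_upwards [Measure.ae_ae_of_ae_prod aT] with ω hω
    obtain ⟨y, hy⟩ := hω.exists
    have hy2 := hy.2
    simp only [hT, cascadeTotal_one_markedConfig] at hy2
    refine (ENNReal.summable_toReal hy2).congr fun α => ?_
    rw [ENNReal.toReal_ofReal (Real.exp_pos _).le]
  · have h1 : ∀ᵐ q ∂(Q.map fun p => ((fun α => ruelleWeight x α p.1), ungroupMarks p.2)),
        leafSum ψ q ≠ ∞ := by
      refine (ae_map_iff mΘ'.aemeasurable (mR (measurableSet_singleton ∞).compl)).2 ?_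
      filter_upwards [hR, aS, aT] with p hp hpS hpT
      rw [hp]
      exact ENNReal.div_ne_top hpS.2 hpT.1
    -- A property of the joint law only, so it passes from the product space to the original labels.
    rw [← hmap] at h1
    filter_upwards [ae_of_ae_map mΘ h1] with ω hω using summable_ruelleWeight_mul hω
  · have h1 : Integrable (fun q => Real.log (leafSum ψ q).toReal)
        (Q.map fun p => ((fun α => ruelleWeight x α p.1), ungroupMarks p.2)) := by
      rw [integrable_map_measure mlog.aestronglyMeasurable mΘ'.aemeasurable]
      exact (iS.sub iT).congr hlogR
    rw [← hmap, integrable_map_measure mlog.aestronglyMeasurable mΘ] at h1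
    exact h1
  · have h1 := integral_map mΘ (f := fun q => Real.log (leafSum ψ q).toReal)
      mlog.aestronglyMeasurable
    rw [hmap, integral_map mΘ'.aemeasurable mlog.aestronglyMeasurable, ← integral_congr_ae hlogR,
      integral_sub iS iT, hlog, add_sub_cancel_right] at h1
    exact h1
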